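/- **Setting.** Let $\hbar,c,m,e>0$ and $q\neq0$ be real constants, $\iota=q/|q|$, $Z=|q|/e$, $\Phi_0=2\pi\hbar c/e$. Let $\Gamma=\mathbb Za+\mathbb Zb\subset\mathbb R^2$ be a lattice with $\Omega=a_1b_2-a_2b_1>0$, dual vectors $a^*=\Omega^{-1}(b_2,-b_1)$, $b^*=\Omega^{-1}(-a_2,a_1)$, and $E_0=\hbar^2/(m\Omega)$. Let $V_\Gamma:\mathbb R^2\to\mathbb R$ and $A_\Gamma:\mathbb R^2\to\mathbb R^2$ be $\Gamma$-periodic, and suppose that Assumption $(A_s)$ holds: $V_\Gamma$ and both components of $A_\Gamma$ are in $C^\infty_b(\mathbb R^2,\mathbb R)$. The gauge is $\nabla\cdot A_\Gamma=0$. Put $\natural=0$ if $A_\Gamma\neq0$ and $\natural=1$ if $A_\Gamma=0$. Let $v_{n,m}$, $f^{(1)}_{n,m}$, $f^{(2)}_{n,m}$ be the Fourier coefficients (with respect to $e^{2\pi i(n\,a^*\cdot r+m\,b^*\cdot r)}$, $n,m\in\mathbb Z$) of $$\tfrac1{E_0}\Big(V_\Gamma+\tfrac{q^2}{2mc^2}|A_\Gamma|^2\Big),\qquad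 2\pi\tfrac{Z\Omega}{\Phi_0}\,a^*\cdot A_\Gamma,\qquad 2\pi\tfrac{Z\Omega}{\Phi_0}\,b^*\cdot A_\Gamma .$$ On $\mathcal H_f=L^2(\mathbb R,dx)$ let $Q$ be multiplication by $x$, $P=-i\iota\,\frac{d}{dx}$, and let $$\Xi=\tfrac1{2\Omega}\big(|a|^2P^2+|b|^2Q^2-a\cdot b\,(QP+PQ)\big),\qquad I_{n,m}=nP-mQ .$$ Put $z_a=(a_1-ia_2)/\sqrt\Omega$, $z_b=(b_1-ib_2)/\sqrt\Omega$, $\mathfrak a=\frac{i}{\sqrt2}(\overline{z_a}P-\overline{z_b}Q)$ and $\mathfrak a^\dagger=\frac{-i}{\sqrt2}(z_aP-z_bQ)$, so that $[\mathfrak a,\mathfrak a^\dagger]=\iota$. The generalized Hermite functions are $\psi_k=(k!)^{-1/2}(\mathfrak c)^k\psi_0$, $k\ge0$, where $\mathfrak c=\mathfrak a^\dagger$ if $\iota=1$, $\mathfrak c=\mathfrak a$ if $\iota=-1$, and $\psi_0(x)=(2\beta/\pi)^{1/4}e^{-(\beta-i\iota\alpha)x^2}$ with $\alpha=\frac{a\cdot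 b}{2|a|^2}$, $\beta=\frac{\Omega}{2|a|^2}$. Let $\mathcal L$ be their linear span. The operators $\Xi$, $Q$, $P$, $I_{n,m}^j$, $I_{n,m}^j(f^{(1)}_{n,m}Q+f^{(2)}_{n,m}P)$ are understood as the closures in $\mathcal H_f$ of their restrictions to $\mathcal L$; $\mathcal F$ is the domain of $\Xi$, with the norm $\|\psi\|_{\mathcal F}=\|\Xi\psi\|$. For $\delta>0$ and $(p,x)\in\mathbb R^2$ put $H_\delta(p,x)=\Xi+\delta W_\delta(p,x)+\delta^2V_\delta(p,x)$ with $$V_\delta(p,x)=\sum_{n,m}v_{n,m}e^{2\pi i(np+mx)}e^{2\pi i\delta I_{n,m}},\qquad W_\delta(p,x)=\sum_{n,m}e^{2\pi i(np+mx)}e^{2\pi i\delta I_{n,m}}\big(f^{(1)}_{n,m}Q+f^{(2)}_{n,m}P\big),$$ and let $\widetilde H^\natural_\delta(p,x)=\Xi+\sum_{j=1}^{2(1+\natural)}\delta^j(W_j+V_j)(p,x)$ be its truncated expansion, where $V_1=0$ and, for $j\ge0$, $$V_{j+2}=\tfrac{(2\pi i)^j}{j!}\sum_{n,m}e^{2\pi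 i(np+mx)}v_{n,m}I_{n,m}^j,\qquad W_{j+1}=\tfrac{(2\pi i)^j}{j!}\sum_{n,m}e^{2\pi i(np+mx)}I_{n,m}^j\big(f^{(1)}_{n,m}Q+f^{(2)}_{n,m}P\big).$$ Let $R^\natural_\delta=H_\delta-\widetilde H^\natural_\delta$ be the remainder symbol. **Proposition 4.5.** 1. There is a constant $C$ such that for all $\delta>0$ and all $(p,x)\in\mathbb R^2$ the operator $R^\natural_\delta(p,x)$ is defined on all of $\mathcal F$ and $$\|R^\natural_\delta(p,x)\|_{\mathcal B(\mathcal F,\mathcal H_f)}\le C\,\delta^{2(\natural+1)} .$$ 2. For every finite set $s\subset\mathbb N$, with $\pi_r=\sum_{k\in s}|\psi_k\rangle\langle\psi_k|$, there is a constant $C$ such that for all $\delta>0$ and all $(p,x)\in\mathbb R^2$ the operator $R^\natural_\delta(p,x)\pi_r$ is bounded on $\mathcal H_f$, the operator $\pi_rR^\natural_\delta(p,x)$ (defined on $\mathcal F$) extends to a bounded operator on $\mathcal H_f$, and $$\|R^\natural_\delta(p,x)\,\pi_r\|_{\mathcal B(\mathcal H_f)}=\|\pi_r\,R^\natural_\delta(p,x)\|_{\mathcal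 B(\mathcal H_f)}\le C\,\delta^{2(\natural+1)+1},\qquad \|[R^\natural_\delta(p,x);\pi_r]\|_{\mathcal B(\mathcal H_f)}\le C\,\delta^{2(\natural+1)+1}.$$ -/

import Mathlib

open MeasureTheory
open scoped ContDiff

noncomputable section

/-- The plane `ℝ²` with its Euclidean structure. -/
abbrev Plane : Type := EuclideanSpace ℝ (Fin 2)

/-- The Hilbert space `H_f = L²(ℝ, dx_f)` of the fast degrees of freedom. -/
abbrev Hf : Type := Lp ℂ 2 (volume : Measure ℝ)

/-- Schwartz functions of the fast variable. -/
abbrev Sch : Type := SchwartzMap ℝ ℂ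

/-- The inclusion of the Schwartz space in `L²(ℝ)`. -/
def schIncl : Sch →L[ℂ] Hf := SchwartzMap.toLpCLM ℂ ℂ 2 volume

/-! ### Complex Gaussians are Schwartz functions -/

theorem gauss_bound (c : ℝ) (hc : 0 < c) (n : ℕ) :
    ∃ C : ℝ, ∀ x : ℝ, |x| ^ n * Real.exp (-(c * x ^ 2)) ≤ C := by
  refine ⟨1 + (n.factorial : ℝ) / c ^ n, fun x => ?_⟩
  have h1 : |x| ^ n ≤ 1 + |x| ^ (2 * n) := by
    rcases le_total |x| 1 with h | h
    · have := pow_le_one₀ (n := n) (abs_nonneg x) h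
      have h2 : 0 ≤ |x| ^ (2 * n) := by positivity
      linarith
    · have := pow_le_pow_right₀ h (show n ≤ 2 * n by omega)
      linarith
  have h2 : (c * x ^ 2) ^ n ≤ n.factorial * Real.exp (c * x ^ 2) := by
    have := Real.pow_div_factorial_le_exp (x := c * x ^ 2) (by positivity) n
    rw [div_le_iff₀ (by positivity)] at this
    linarith
  have hexp : Real.exp (c * x ^ 2) * Real.exp (-(c * x ^ 2)) = 1 := by
    rw [← Real.exp_add]; simp
  have h3 : |x| ^ (2 * n) * Real.exp (-(c * x ^ 2)) ≤ n.factorial / c ^ n := by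
    rw [le_div_iff₀ (by positivity)]
    have h4 : |x| ^ (2 * n) * Real.exp (-(c * x ^ 2)) * c ^ n
        = (c * x ^ 2) ^ n * Real.exp (-(c * x ^ 2)) := by
      rw [mul_pow, pow_mul, sq_abs]; ring
    rw [h4]
    calc _ ≤ (n.factorial * Real.exp (c * x ^ 2)) * Real.exp (-(c * x ^ 2)) :=
          mul_le_mul_of_nonneg_right h2 (Real.exp_pos _).le
      _ = n.factorial := by rw [mul_assoc, hexp, mul_one]
  have h5 : Real.exp (-(c * x ^ 2)) ≤ 1 := Real.exp_le_one_iff.2 (by nlinarith [sq_nonneg x])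
  calc |x| ^ n * Real.exp (-(c * x ^ 2))
      ≤ (1 + |x| ^ (2 * n)) * Real.exp (-(c * x ^ 2)) :=
        mul_le_mul_of_nonneg_right h1 (Real.exp_pos _).le
    _ ≤ _ := by rw [add_mul, one_mul]; linarith

theorem gauss_poly_bound (w : ℂ) (hw : 0 < w.re) (P : Polynomial ℂ) :
    ∃ C : ℝ, ∀ x : ℝ, ‖P.eval (x : ℂ) * Complex.exp (-w * (x : ℂ) ^ 2)‖ ≤ C := by
  have hre : ∀ x : ℝ, ‖Complex.exp (-w * (x : ℂ) ^ 2)‖ = Real.exp (-(w.re * x ^ 2)) := by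
    intro x
    rw [Complex.norm_exp]
    congr 1
    rw [← Complex.ofReal_pow, Complex.re_mul_ofReal, Complex.neg_re]
    ring
  induction P using Polynomial.induction_on' with
  | add p q hp hq =>
    obtain ⟨C, hC⟩ := hp
    obtain ⟨D, hD⟩ := hq
    refine ⟨C + D, fun x => ?_⟩
    rw [Polynomial.eval_add, add_mul]
    exact (norm_add_le _ _).trans (add_le_add (hC x) (hD x))
  | monomial n a =>
    obtain ⟨C, hC⟩ := gauss_bound w.re hw n
    refine ⟨‖a‖ * C, fun x => ?_⟩
    rw [norm_mul, hre, Polynomial.eval_monomial, norm_mul, norm_pow, Complex.norm_real,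
      Real.norm_eq_abs, mul_assoc]
    exact mul_le_mul_of_nonneg_left (hC x) (norm_nonneg a)

theorem gauss_iteratedDeriv (w : ℂ) (n : ℕ) : ∃ P : Polynomial ℂ,
    iteratedDeriv n (fun x : ℝ => Complex.exp (-w * (x : ℂ) ^ 2))
      = fun x : ℝ => P.eval (x : ℂ) * Complex.exp (-w * (x : ℂ) ^ 2) := by
  induction n with
  | zero => exact ⟨1, by simp⟩
  | succ n ih =>
    obtain ⟨P, hP⟩ := ih
    refine ⟨P.derivative + P * (Polynomial.C (-w) * (2 * Polynomial.X)), ?_⟩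
    rw [iteratedDeriv_succ, hP]
    funext x
    have h1 : HasDerivAt (fun x : ℝ => P.eval (x : ℂ)) (P.derivative.eval (x : ℂ)) x :=
      (P.hasDerivAt (x : ℂ)).comp_ofReal
    have h2 : HasDerivAt (fun z : ℂ => Complex.exp (-w * z ^ 2))
        (Complex.exp (-w * (x : ℂ) ^ 2) * (-w * (2 * (x : ℂ)))) (x : ℂ) := by
      have := ((hasDerivAt_pow 2 (x : ℂ)).const_mul (-w)).cexp
      simpa using this
    have h3 := h1.mul h2.comp_ofReal
    refine h3.deriv.trans ?_
    simp
    ring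

/-- The Gaussian `x ↦ exp (-w x²)`, `Re w > 0`, as a Schwartz function. -/
def gaussSch (w : ℂ) (hw : 0 < w.re) : Sch where
  toFun x := Complex.exp (-w * (x : ℂ) ^ 2)
  smooth' := by
    have : ContDiff ℝ ∞ (fun x : ℝ => (x : ℂ)) := Complex.ofRealCLM.contDiff
    exact (contDiff_const.mul (this.pow 2)).cexp
  decay' := by
    intro k n
    obtain ⟨P, hP⟩ := gauss_iteratedDeriv w n
    obtain ⟨C, hC⟩ := gauss_poly_bound w hw (Polynomial.X ^ k * P)
    refine ⟨C, fun x => ?_⟩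
    rw [norm_iteratedFDeriv_eq_norm_iteratedDeriv, hP]
    have := hC x
    rw [Polynomial.eval_mul, Polynomial.eval_pow, Polynomial.eval_X, mul_assoc, norm_mul,
      norm_pow, Complex.norm_real] at this
    exact this

/-! ### Unbounded operators -/

/-- The sum of a series of unbounded operators: its domain consists of the vectors that lie in
the domain of every term and for which the series converges in `H_f`. -/
def opSeries {ι : Type} (T : ι → (Hf →ₗ.[ℂ] Hf)) : Hf →ₗ.[ℂ] Hf where
  domain :=
    { carrier := {ψ | ∃ h : ∀ i, ψ ∈ (T i).domain, Summable fun i => T i ⟨ψ, h i⟩}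
      zero_mem' := ⟨fun i => (T i).domain.zero_mem, by
        have : (fun i => T i ⟨0, (T i).domain.zero_mem⟩) = fun _ => 0 :=
          funext fun i => (T i).map_zero
        rw [this]; exact summable_zero⟩
      add_mem' := by
        rintro x y ⟨hx, sx⟩ ⟨hy, sy⟩
        refine ⟨fun i => (T i).domain.add_mem (hx i) (hy i), ?_⟩
        have : (fun i => T i ⟨x + y, (T i).domain.add_mem (hx i) (hy i)⟩)
            = fun i => T i ⟨x, hx i⟩ + T i ⟨y, hy i⟩ :=
          funext fun i => (T i).map_add ⟨x, hx i⟩ ⟨y, hy i⟩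
        rw [this]; exact sx.add sy
      smul_mem' := by
        rintro c x ⟨hx, sx⟩
        refine ⟨fun i => (T i).domain.smul_mem c (hx i), ?_⟩
        have : (fun i => T i ⟨c • x, (T i).domain.smul_mem c (hx i)⟩)
            = fun i => c • T i ⟨x, hx i⟩ :=
          funext fun i => (T i).map_smul c ⟨x, hx i⟩
        rw [this]; exact sx.const_smul c }
  toFun :=
    { toFun := fun ψ => ∑' i, T i ⟨ψ.1, ψ.2.1 i⟩
      map_add' := by
        rintro ⟨x, hx, sx⟩ ⟨y, hy, sy⟩
        rw [← sx.tsum_add sy]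
        exact tsum_congr fun i => (T i).map_add ⟨x, hx i⟩ ⟨y, hy i⟩
      map_smul' := by
        rintro c ⟨x, hx, sx⟩
        rw [RingHom.id_apply, ← sx.tsum_const_smul c]
        exact tsum_congr fun i => (T i).map_smul c ⟨x, hx i⟩ }

/-- Multiplication by the phase `x ↦ exp (i v x)`, an isometry of `H_f`. -/
def phaseMul (v : ℝ) : Hf →ₗᵢ[ℂ] Hf where
  toFun ψ := MemLp.toLp (fun x : ℝ => Complex.exp (Complex.I * (v * x : ℝ)) * ψ x)
    ((Lp.memLp ψ).of_le (by
        have := Lp.aestronglyMeasurable ψ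
        have h : Continuous fun x : ℝ => Complex.exp (Complex.I * (v * x : ℝ)) := by fun_prop
        exact h.aestronglyMeasurable.mul this)
      (Filter.Eventually.of_forall fun x => by
        rw [norm_mul, mul_comm Complex.I, Complex.norm_exp_ofReal_mul_I, one_mul]))
  map_add' f g := by
    rw [← MemLp.toLp_add]
    apply MemLp.toLp_congr
    filter_upwards [Lp.coeFn_add f g] with x hx
    rw [hx]
    simp only [Pi.add_apply, mul_add]
  map_smul' c f := by
    rw [RingHom.id_apply, ← MemLp.toLp_const_smul]
    apply MemLp.toLp_congr
    filter_upwards [Lp.coeFn_smul c f] with x hx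
    simp only [hx, Pi.smul_apply, smul_eq_mul]
    ring
  norm_map' f := by
    simp only [LinearMap.coe_mk, AddHom.coe_mk]
    rw [Lp.norm_toLp, Lp.norm_def]
    congr 1
    apply eLpNorm_congr_norm_ae
    refine Filter.Eventually.of_forall fun x => ?_
    rw [norm_mul, mul_comm Complex.I, Complex.norm_exp_ofReal_mul_I, one_mul]

/-- The translation `ψ ↦ ψ (· + t)`, an isometry of `H_f`. -/
def shift (t : ℝ) : Hf →ₗᵢ[ℂ] Hf :=
  Lp.compMeasurePreservingₗᵢ ℂ (fun x : ℝ => x + t) (measurePreserving_add_right volume t)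

/-- The Weyl operator `exp (i (u P + v Q))` in the Schrödinger representation
`Q = x`, `P = -i ι d/dx` (`ι = ± 1`, so that `[Q, P] = i ι`): the unitary
`(exp (i (u P + v Q)) ψ)(x) = exp (i ι u v / 2) exp (i v x) ψ(x + ι u)`. -/
def weyl (ι u v : ℝ) : Hf →L[ℂ] Hf :=
  Complex.exp (Complex.I * (ι * u * v / 2 : ℝ)) •
    ((phaseMul v).toContinuousLinearMap ∘L (shift (ι * u)).toContinuousLinearMap)

/-! ### The model -/

/-- The data of the Bloch-Landau model without external potentials other than the uniform
magnetic field: positive physical constants (reduced Planck constant `hbar`, speed of light `c`,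
mass `m`, elementary charge `e`), a charge `q ≠ 0`, an oriented lattice `Γ = ℤ a + ℤ b`, and
`Γ`-periodic internal potentials `V_Γ` and `A_Γ`. -/
structure BlochLandau where
  hbar : ℝ
  c : ℝ
  m : ℝ
  e : ℝ
  q : ℝ
  hbar_pos : 0 < hbar
  c_pos : 0 < c
  m_pos : 0 < m
  e_pos : 0 < e
  q_ne : q ≠ 0
  a : Plane
  b : Plane
  area_pos : 0 < a 0 * b 1 - a 1 * b 0
  VΓ : Plane → ℝ
  AΓ : Plane → Plane
  V_per : ∀ r, VΓ (r + a) = VΓ r ∧ VΓ (r + b) = VΓ r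
  A_per : ∀ r, AΓ (r + a) = AΓ r ∧ AΓ (r + b) = AΓ r

/-- `f` is smooth, and it and all its derivatives are bounded. -/
def IsCbInfty {E : Type} [NormedAddCommGroup E] [NormedSpace ℝ E] (f : Plane → E) : Prop :=
  ContDiff ℝ ∞ f ∧ ∀ k : ℕ, ∃ C : ℝ, ∀ r, ‖iteratedFDeriv ℝ k f r‖ ≤ C

namespace BlochLandau

variable (M : BlochLandau)

/-- The strong assumption on the internal potentials: `V_Γ` and the two components of `A_Γ` are
of class `C_b^∞(ℝ², ℝ)`. -/
def AssumptionAs : Prop :=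
  IsCbInfty M.VΓ ∧ ∀ j : Fin 2, IsCbInfty fun r => M.AΓ r j

/-- The gauge condition `∇ · A_Γ = 0`. -/
def DivFree : Prop :=
  ∀ r, ∑ j : Fin 2, fderiv ℝ (fun r => M.AΓ r j) r (EuclideanSpace.single j 1) = 0

/-- The area `Ω_Γ = a₁ b₂ - a₂ b₁` of the fundamental cell. -/
def area : ℝ := M.a 0 * M.b 1 - M.a 1 * M.b 0

/-- The sign `ι_q = ± 1` of the charge. -/
def sgn : ℝ := if 0 < M.q then 1 else -1

/-- The dual vector `a^* = Ω_Γ⁻¹ (b₂, -b₁)`. -/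
def aStar : Plane := !₂[M.b 1 / M.area, -M.b 0 / M.area]

/-- The dual vector `b^* = Ω_Γ⁻¹ (-a₂, a₁)`. -/
def bStar : Plane := !₂[-M.a 1 / M.area, M.a 0 / M.area]

/-- The natural unit of energy `E₀ = ℏ² / (m Ω_Γ)`. -/
def energyUnit : ℝ := M.hbar ^ 2 / (M.m * M.area)

/-- The flux quantum `Φ₀ = h c / e`, with `h = 2 π ℏ`. -/
def fluxQuantum : ℝ := 2 * Real.pi * M.hbar * M.c / M.e

/-- The charge number `Z = |q| / e`. -/
def chargeNumber : ℝ := |M.q| / M.e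

/-- The dimensionless scalar potential
`E₀⁻¹ (V_Γ + q² / (2 m c²) |A_Γ|²)` as a `Γ`-periodic function of `r`. -/
def potV (r : Plane) : ℝ :=
  (M.VΓ r + M.q ^ 2 / (2 * M.m * M.c ^ 2) * ‖M.AΓ r‖ ^ 2) / M.energyUnit

/-- `f₁(a^*·r, b^*·r) = 2 π (Z Ω_Γ / Φ₀) (a^* · A_Γ)(r)`. -/
def potF₁ (r : Plane) : ℝ :=
  2 * Real.pi * (M.chargeNumber * M.area / M.fluxQuantum) * inner ℝ M.aStar (M.AΓ r)

/-- `f₂(a^*·r, b^*·r) = 2 π (Z Ω_Γ / Φ₀) (b^* · A_Γ)(r)`. -/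
def potF₂ (r : Plane) : ℝ :=
  2 * Real.pi * (M.chargeNumber * M.area / M.fluxQuantum) * inner ℝ M.bStar (M.AΓ r)

/-- The Fourier coefficient `F_{n,m}` of a `Γ`-periodic function
`F(r) = ∑ F_{n,m} exp (2 π i (n a^*·r + m b^*·r))`; the point `r = x₁ a + x₂ b` has
`a^*·r = x₁` and `b^*·r = x₂`. -/
def fourierCoef (F : Plane → ℝ) (n : ℤ × ℤ) : ℂ :=
  ∫ x₁ in (0 : ℝ)..1, ∫ x₂ in (0 : ℝ)..1,
    Complex.exp (-(2 * Real.pi * Complex.I * (n.1 * x₁ + n.2 * x₂))) *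
      (F (x₁ • M.a + x₂ • M.b) : ℂ)

/-- The indicator `♮` of the periodic vector potential: `0` if `A_Γ ≠ 0`, and `1` if
`A_Γ = 0`. -/
def nat : ℕ := open Classical in if M.AΓ = 0 then 1 else 0

/-! ### Fast operators on Schwartz functions -/

/-- `Q_f`, multiplication by `x`, on Schwartz functions. -/
def Q : Sch →L[ℂ] Sch := SchwartzMap.smulLeftCLM ℂ fun x : ℝ => (x : ℂ)

/-- `P_f = -i ι_q d/dx` on Schwartz functions. -/
def P : Sch →L[ℂ] Sch := (-(Complex.I * M.sgn)) • SchwartzMap.derivCLM ℂ ℂ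

/-- `Ξ = (2 Ω_Γ)⁻¹ (|a|² P_f² + |b|² Q_f² - a·b (Q_f P_f + P_f Q_f))` on Schwartz functions. -/
def xiSch : Sch →L[ℂ] Sch :=
  ((1 / (2 * M.area) : ℝ) : ℂ) •
    (((‖M.a‖ ^ 2 : ℝ) : ℂ) • (M.P ∘L M.P) + ((‖M.b‖ ^ 2 : ℝ) : ℂ) • (Q ∘L Q)
      - ((inner ℝ M.a M.b : ℝ) : ℂ) • (Q ∘L M.P + M.P ∘L Q))

/-- `I_{n,m} = n P_f - m Q_f` on Schwartz functions. -/
def iSch (n : ℤ × ℤ) : Sch →L[ℂ] Sch := (n.1 : ℂ) • M.P - (n.2 : ℂ) • Q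

/-- `z_a = (a₁ - i a₂) / √Ω_Γ`. -/
def za : ℂ := ((M.a 0 : ℂ) - Complex.I * (M.a 1 : ℂ)) / (Real.sqrt M.area : ℂ)

/-- `z_b = (b₁ - i b₂) / √Ω_Γ`. -/
def zb : ℂ := ((M.b 0 : ℂ) - Complex.I * (M.b 1 : ℂ)) / (Real.sqrt M.area : ℂ)

/-- The operator `𝔞 = (i / √2) (conj z_a P_f - conj z_b Q_f)`. -/
def aOp : Sch →L[ℂ] Sch :=
  (Complex.I / (Real.sqrt 2 : ℂ)) •
    ((starRingEnd ℂ M.za) • M.P - (starRingEnd ℂ M.zb) • Q)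

/-- The operator `𝔞† = (-i / √2) (z_a P_f - z_b Q_f)`. -/
def aDag : Sch →L[ℂ] Sch :=
  (-Complex.I / (Real.sqrt 2 : ℂ)) • (M.za • M.P - M.zb • Q)

/-- The creation operator. As `[𝔞, 𝔞†] = ι_q`, it is `𝔞†` for a positive and `𝔞` for a negative
charge. -/
def creation : Sch →L[ℂ] Sch := if 0 < M.q then M.aDag else M.aOp

/-- `α = a·b / (2 |a|²)`. -/
def gaussα : ℝ := inner ℝ M.a M.b / (2 * ‖M.a‖ ^ 2)

/-- `β = Ω_Γ / (2 |a|²)`. -/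
def gaussβ : ℝ := M.area / (2 * ‖M.a‖ ^ 2)

theorem gaussβ_pos : 0 < M.gaussβ := by
  have h : M.a ≠ 0 := by
    intro h
    have := M.area_pos
    simp [h] at this
  have h2 : 0 < ‖M.a‖ := norm_pos_iff.2 h
  have h3 : 0 < M.area := M.area_pos
  unfold gaussβ
  positivity

/-- The normalized ground state `ψ₀(x) = (2 β / π)^{1/4} exp (-(β - i ι_q α) x²)`. -/
def ground : Sch :=
  (((2 * M.gaussβ / Real.pi) ^ (1 / 4 : ℝ) : ℝ) : ℂ) •
    gaussSch (M.gaussβ - Complex.I * (M.sgn * M.gaussα : ℝ)) (by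
      simpa using M.gaussβ_pos)

/-- The generalized Hermite functions: `ψ_k` is `(k!)^{-1/2}` times the `k`-th power of the
creation operator applied to `ψ₀`. -/
def hermite (k : ℕ) : Sch :=
  ((1 / Real.sqrt k.factorial : ℝ) : ℂ) • (M.creation ^ k) M.ground

/-- The space `𝓛` of finite linear combinations of generalized Hermite functions. -/
def hermiteSpan : Submodule ℂ Sch := Submodule.span ℂ (Set.range M.hermite)

/-- The operator `T` of the Schwartz space, as an unbounded operator of `H_f` with the domain
`𝓛`; it is given by its graph. -/
def onHermite (T : Sch →L[ℂ] Sch) : Hf →ₗ.[ℂ] Hf :=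
  (M.hermiteSpan.map
    (schIncl.toLinearMap.prod (schIncl ∘L T).toLinearMap)).toLinearPMap

/-- The closure in `H_f` of the operator `T` on `𝓛`. -/
def closedOp (T : Sch →L[ℂ] Sch) : Hf →ₗ.[ℂ] Hf := (M.onHermite T).closure

/-- The operator `Ξ` with its domain of self-adjointness `F`, the closure of `𝓛` in the graph
norm; `F = M.xi.domain` carries the norm `ψ ↦ ‖Ξ ψ‖`. -/
def xi : Hf →ₗ.[ℂ] Hf := M.closedOp M.xiSch

/-! ### The symbols -/

/-- The phase `exp (2 π i (n p_s + m x_s))`. -/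
def phase (p x : ℝ) (n : ℤ × ℤ) : ℂ :=
  Complex.exp (2 * Real.pi * Complex.I * (n.1 * p + n.2 * x))

/-- The unitary `exp (2 π i δ I_{n,m}) = exp (2 π i δ (n P_f - m Q_f))`. -/
def expI (δ : ℝ) (n : ℤ × ℤ) : Hf →L[ℂ] Hf :=
  weyl M.sgn (2 * Real.pi * δ * n.1) (-(2 * Real.pi * δ * n.2))

/-- `V_δ(p_s, x_s) = ∑ v_{n,m} exp (2 π i (n p_s + m x_s)) exp (2 π i δ I_{n,m})`. -/
def symV (δ p x : ℝ) : Hf →ₗ.[ℂ] Hf :=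
  opSeries fun n : ℤ × ℤ =>
    (M.fourierCoef M.potV n * phase p x n) • (M.expI δ n).toLinearMap.toPMap ⊤

/-- `W_δ(p_s, x_s) = ∑ exp (2 π i (n p_s + m x_s)) exp (2 π i δ I_{n,m})
(f¹_{n,m} Q_f + f²_{n,m} P_f)`. -/
def symW (δ p x : ℝ) : Hf →ₗ.[ℂ] Hf :=
  opSeries fun n : ℤ × ℤ =>
    phase p x n • (M.expI δ n).toLinearMap.compPMap
      (M.fourierCoef M.potF₁ n • M.closedOp Q + M.fourierCoef M.potF₂ n • M.closedOp M.P)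

/-- The symbol `H_δ = Ξ + δ W_δ + δ² V_δ`. -/
def symH (δ p x : ℝ) : Hf →ₗ.[ℂ] Hf :=
  M.xi + (δ : ℂ) • M.symW δ p x + ((δ ^ 2 : ℝ) : ℂ) • M.symV δ p x

/-- `V_{j+2}(p_s, x_s) = (2 π i)^j / j! ∑ exp (2 π i (n p_s + m x_s)) v_{n,m} I_{n,m}^j`, the
coefficient of `δ^j` in the expansion of `V_δ`, and `V_0 = V_1 = 0`. -/
def coefV (p x : ℝ) : ℕ → (Hf →ₗ.[ℂ] Hf)
  | 0 => 0
  | 1 => 0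
  | j + 2 => ((2 * Real.pi * Complex.I) ^ j / (j.factorial : ℂ)) •
      opSeries fun n : ℤ × ℤ =>
        (phase p x n * M.fourierCoef M.potV n) • M.closedOp (M.iSch n ^ j)

/-- `M^j_{n,m} = I_{n,m}^j (f¹_{n,m} Q_f + f²_{n,m} P_f)`. -/
def opM (j : ℕ) (n : ℤ × ℤ) : Hf →ₗ.[ℂ] Hf :=
  M.closedOp ((M.iSch n ^ j) ∘L
    (M.fourierCoef M.potF₁ n • Q + M.fourierCoef M.potF₂ n • M.P))

/-- `W_{j+1}(p_s, x_s) = (2 π i)^j / j! ∑ exp (2 π i (n p_s + m x_s)) M^j_{n,m}`, the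
coefficient of `δ^j` in the expansion of `W_δ`, and `W_0 = 0`. -/
def coefW (p x : ℝ) : ℕ → (Hf →ₗ.[ℂ] Hf)
  | 0 => 0
  | j + 1 => ((2 * Real.pi * Complex.I) ^ j / (j.factorial : ℂ)) •
      opSeries fun n : ℤ × ℤ => phase p x n • M.opM j n

/-- `H_j = W_j + V_j`. -/
def coefH (p x : ℝ) (j : ℕ) : Hf →ₗ.[ℂ] Hf := M.coefW p x j + M.coefV p x j

/-- The approximated symbol `H̃^♮_δ = Ξ + ∑_{j=1}^{2 (1 + ♮)} δ^j H_j`. -/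
def symApprox (δ p x : ℝ) : Hf →ₗ.[ℂ] Hf :=
  M.xi + ∑ j ∈ Finset.Icc 1 (2 * (1 + M.nat)), ((δ ^ j : ℝ) : ℂ) • M.coefH p x j

/-- The remainder symbol `R^♮_δ = H_δ - H̃^♮_δ`. -/
def remainder (δ p x : ℝ) : Hf →ₗ.[ℂ] Hf := M.symH δ p x - M.symApprox δ p x

/-! ### Norms -/

/-- `T` maps all of `F` to `H_f`, with `‖T‖_{B(F, H_f)} ≤ K`, where `‖ψ‖_F = ‖Ξ ψ‖`. -/
def NormFLe (T : Hf →ₗ.[ℂ] Hf) (K : ℝ) : Prop :=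
  ∀ ψ : M.xi.domain, ∃ h : (ψ : Hf) ∈ T.domain, ‖T ⟨ψ, h⟩‖ ≤ K * ‖M.xi ψ‖

/-- The orthogonal projection `π_r = ∑_{k ∈ s} |ψ_k⟩⟨ψ_k|` on the span of finitely many
generalized Hermite functions. -/
def proj (s : Finset ℕ) : Hf →L[ℂ] Hf :=
  ∑ k ∈ s, InnerProductSpace.rankOne ℂ (schIncl (M.hermite k)) (schIncl (M.hermite k))

/-- The bounded operator `S` is `T π_r`, defined on all of `H_f`. -/
def IsRightComp (T : Hf →ₗ.[ℂ] Hf) (s : Finset ℕ) (S : Hf →L[ℂ] Hf) : Prop :=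
  ∀ ψ : Hf, ∃ h : M.proj s ψ ∈ T.domain, S ψ = T ⟨M.proj s ψ, h⟩

/-- The bounded operator `S` extends `π_r T`, defined on the dense subspace `F`. -/
def IsLeftComp (T : Hf →ₗ.[ℂ] Hf) (s : Finset ℕ) (S : Hf →L[ℂ] Hf) : Prop :=
  ∀ ψ : M.xi.domain, ∃ h : (ψ : Hf) ∈ T.domain, S ψ = M.proj s (T ⟨ψ, h⟩)

end BlochLandau

end

/-!
Fourier mode by Fourier mode, `R_δ` is made of the Taylor remainders of the unitaries
`exp (2πiδ I_{n,m})`, and `♮` only fixes the orders at which the Taylor series are cut. On Schwartz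
functions such a remainder of order `N` is bounded by `(2πδ)^N ‖I_{n,m}^N φ‖`, and the Fourier
coefficients decay fast enough to sum over the modes.

On `𝓕` one can only afford polynomials of degree two in `P` and `Q`, which the oscillator `Ξ`
dominates; so each remainder is bounded as the sum of the remainder of the next lower order and of
the last Taylor term, at the cost of one factor `δ`. On finitely many Hermite functions all powers
of `I_{n,m}` are available, and this factor is not lost.

By the gauge condition, `f⁽¹⁾_{n,m} Q + f⁽²⁾_{n,m} P` is a multiple of `I_{n,m}` up to the mode
`(0, 0)`, hence commutes with `exp (2πiδ I_{n,m})`. So `R_δ` is symmetric, and `π_r R_δ` is the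
adjoint of the bounded operator `R_δ π_r`.
-/

noncomputable section

/-! ### Formal adjoints and Taylor remainders of unitary groups -/

section Core

variable {D H : Type*} [AddCommGroup D] [Module ℂ D] [TopologicalSpace D]
  [NormedAddCommGroup H] [InnerProductSpace ℂ H] {ι : D →L[ℂ] H}

theorem norm_le_of_forall_norm_inner_le (hι : DenseRange ι) {v : H} {K : ℝ}
    (hK : 0 ≤ K) (h : ∀ χ, ‖inner ℂ v (ι χ)‖ ≤ K * ‖ι χ‖) : ‖v‖ ≤ K := by
  rw [← innerSL_apply_norm (𝕜 := ℂ)]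
  refine ContinuousLinearMap.opNorm_le_bound _ hK fun w => ?_
  exact hι.induction_on w
    (isClosed_le (innerSL ℂ v).continuous.norm (continuous_norm.const_mul K)) h

/-- `u'` is a formal adjoint of `u`, where `u` and `u'` are operators of the Hilbert space `H`
defined on a common core `D`, which is embedded in `H` by `ι`. -/
def IsFormalAdjoint (ι u u' : D →L[ℂ] H) : Prop :=
  ∀ φ χ, inner ℂ (u φ) (ι χ) = inner ℂ (ι φ) (u' χ)

namespace IsFormalAdjoint

variable {u u' w w' : D →L[ℂ] H} {S S' T T' : D →L[ℂ] D}

theorem symm (h : IsFormalAdjoint ι u u') : IsFormalAdjoint ι u' u := fun φ χ => by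
  rw [← inner_conj_symm, ← h, inner_conj_symm]

theorem add (h : IsFormalAdjoint ι u u') (h' : IsFormalAdjoint ι w w') :
    IsFormalAdjoint ι (u + w) (u' + w') := fun φ χ => by
  simp only [add_apply, inner_add_left, inner_add_right, h φ χ, h' φ χ]

theorem smul (h : IsFormalAdjoint ι u u') (c : ℂ) :
    IsFormalAdjoint ι (c • u) (starRingEnd ℂ c • u') := fun φ χ => by
  simp only [smul_apply, inner_smul_left, inner_smul_right, h φ χ]

theorem real_smul (h : IsFormalAdjoint ι u u') (r : ℝ) :
    IsFormalAdjoint ι ((r : ℂ) • u) ((r : ℂ) • u') := by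
  simpa only [Complex.conj_ofReal] using h.smul r

theorem sub (h : IsFormalAdjoint ι u u') (h' : IsFormalAdjoint ι w w') :
    IsFormalAdjoint ι (u - w) (u' - w') := fun φ χ => by
  simp only [sub_apply, inner_sub_left, inner_sub_right, h φ χ, h' φ χ]

theorem sum {κ : Type*} {s : Finset κ} {v v' : κ → D →L[ℂ] H}
    (h : ∀ i ∈ s, IsFormalAdjoint ι (v i) (v' i)) :
    IsFormalAdjoint ι (∑ i ∈ s, v i) (∑ i ∈ s, v' i) := fun φ χ => by
  simp only [sum_apply, sum_inner, inner_sum]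
  exact Finset.sum_congr rfl fun i hi => h i hi φ χ

theorem unique (hι : DenseRange ι) (h : IsFormalAdjoint ι w u) (h' : IsFormalAdjoint ι w u') :
    u = u' := by
  ext χ
  refine sub_eq_zero.1 (norm_le_zero_iff.1 (norm_le_of_forall_norm_inner_le hι le_rfl fun φ => ?_))
  rw [← inner_conj_symm, inner_sub_right, ← h, ← h', sub_self, map_zero, norm_zero, zero_mul]

theorem comp (h : IsFormalAdjoint ι (ι ∘L S) (ι ∘L S'))
    (h' : IsFormalAdjoint ι (ι ∘L T) (ι ∘L T')) :
    IsFormalAdjoint ι (ι ∘L (S ∘L T)) (ι ∘L (T' ∘L S')) := fun φ χ =>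
  (h (T φ) χ).trans (h' φ (S' χ))

theorem pow (h : IsFormalAdjoint ι (ι ∘L T) (ι ∘L T')) (j : ℕ) :
    IsFormalAdjoint ι (ι ∘L T ^ j) (ι ∘L T' ^ j) := by
  induction j with
  | zero => exact fun _ _ => rfl
  | succ j ih => rw [pow_succ T, pow_succ' T']; exact ih.comp h

end IsFormalAdjoint

variable {J J' : D →L[ℂ] D} {U U' : ℝ → D →L[ℂ] H}

/-- On the core `D`, the family `U` of contractions of `H` is, weakly, the solution
`δ ↦ exp (δ J)` of `U' = U J`, `U 0 = 1`. -/
structure IsWeakFlow (ι : D →L[ℂ] H) (J : D →L[ℂ] D) (U : ℝ → D →L[ℂ] H) : Prop where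
  zero : U 0 = ι
  norm_le : ∀ δ φ, ‖U δ φ‖ ≤ ‖ι φ‖
  hasDerivAt : ∀ χ φ δ, HasDerivAt (fun δ => inner ℂ (ι χ) (U δ φ)) (inner ℂ (ι χ) (U δ (J φ))) δ

/-- The Taylor remainder of order `k` of `δ ↦ exp (δ J)` on the core. -/
def taylorRem (ι : D →L[ℂ] H) (J : D →L[ℂ] D) (U : ℝ → D →L[ℂ] H) (k : ℕ) (δ : ℝ) : D →L[ℂ] H :=
  U δ - ∑ j ∈ Finset.range k, ((δ ^ j / j.factorial : ℝ) : ℂ) • (ι ∘L J ^ j)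

theorem taylorRem_succ_apply (k : ℕ) (δ : ℝ) (φ : D) : taylorRem ι J U (k + 1) δ φ
    = taylorRem ι J U k δ φ - ((δ ^ k / k.factorial : ℝ) : ℂ) • ι ((J ^ k) φ) := by
  simp [taylorRem, Finset.sum_range_succ, sub_add_eq_sub_sub]

theorem hasDerivAt_pow_div_factorial (k : ℕ) (δ : ℝ) :
    HasDerivAt (fun δ : ℝ => δ ^ (k + 1) / ((k + 1).factorial : ℝ)) (δ ^ k / k.factorial) δ := by
  refine ((hasDerivAt_pow (k + 1) δ).div_const _).congr_deriv ?_
  rw [Nat.factorial_succ]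
  push_cast
  field_simp

namespace IsWeakFlow

theorem hasDerivAt_inner_taylorRem (h : IsWeakFlow ι J U) (k : ℕ) (χ φ : D) (δ : ℝ) :
    HasDerivAt (fun δ => inner ℂ (ι χ) (taylorRem ι J U (k + 1) δ φ))
      (inner ℂ (ι χ) (taylorRem ι J U k δ (J φ))) δ := by
  induction k with
  | zero => simpa [taylorRem, inner_sub_right] using
      (h.hasDerivAt χ φ δ).sub_const (inner ℂ (ι χ) (ι φ))
  | succ k ih =>
    simp only [taylorRem_succ_apply (k + 1), taylorRem_succ_apply k δ (J φ), inner_sub_right,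
      inner_smul_right]
    exact ih.sub ((hasDerivAt_pow_div_factorial k δ).ofReal_comp.mul_const _)

theorem taylorRem_zero (h : IsWeakFlow ι J U) (k : ℕ) : taylorRem ι J U (k + 1) 0 = 0 := by
  rw [taylorRem, Finset.sum_range_succ']
  simp [h.zero, ContinuousLinearMap.one_def]

theorem norm_taylorRem_le (hι : DenseRange ι) (h : IsWeakFlow ι J U) (k : ℕ) {δ : ℝ} (hδ : 0 ≤ δ)
    (φ : D) : ‖taylorRem ι J U k δ φ‖ ≤ δ ^ k * ‖ι ((J ^ k) φ)‖ := by
  induction k generalizing φ δ with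
  | zero => simpa [taylorRem] using h.norm_le δ φ
  | succ k ih =>
    refine norm_le_of_forall_norm_inner_le hι (by positivity) fun χ => ?_
    have bound := norm_image_sub_le_of_norm_deriv_le_segment' (a := 0) (b := δ)
      (C := ‖ι χ‖ * (δ ^ k * ‖ι ((J ^ k) (J φ))‖))
      (fun s _ => (h.hasDerivAt_inner_taylorRem k χ φ s).hasDerivWithinAt)
      (fun s hs => (norm_inner_le_norm _ _).trans <| by
        refine mul_le_mul_of_nonneg_left ((ih hs.1 (J φ)).trans ?_) (norm_nonneg _)
        exact mul_le_mul_of_nonneg_right (pow_le_pow_left₀ hs.1 hs.2.le k) (norm_nonneg _))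
      δ (Set.right_mem_Icc.2 hδ)
    rw [h.taylorRem_zero, zero_apply, inner_zero_right, sub_zero, norm_inner_symm] at bound
    refine bound.trans_eq ?_
    rw [pow_succ δ, pow_succ J, mul_apply_eq_comp]
    ring

/-- One order of `δ` is given up in order to apply one power of `J` less. -/
theorem norm_taylorRem_succ_le (hι : DenseRange ι) (h : IsWeakFlow ι J U) (k : ℕ) {δ : ℝ}
    (hδ : 0 ≤ δ) (φ : D) :
    ‖taylorRem ι J U (k + 1) δ φ‖ ≤ δ ^ k * (2 * ‖ι ((J ^ k) φ)‖) := by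
  have last_term : ‖((δ ^ k / k.factorial : ℝ) : ℂ) • ι ((J ^ k) φ)‖ ≤ δ ^ k * ‖ι ((J ^ k) φ)‖ := by
    rw [norm_smul, Complex.norm_real, Real.norm_of_nonneg (by positivity)]
    gcongr
    exact div_le_self (by positivity) (by exact_mod_cast k.factorial_pos)
  rw [taylorRem_succ_apply]
  linarith [norm_sub_le (taylorRem ι J U k δ φ) (((δ ^ k / k.factorial : ℝ) : ℂ) • ι ((J ^ k) φ)),
    h.norm_taylorRem_le hι k hδ φ]

theorem isFormalAdjoint_comp (h : IsWeakFlow ι J U) (h' : IsWeakFlow ι J' U')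
    (hU : ∀ δ, IsFormalAdjoint ι (U δ) (U' δ)) (δ : ℝ) :
    IsFormalAdjoint ι (U δ ∘L J) (U' δ ∘L J') := fun φ χ => by
  have left := (h.hasDerivAt χ φ δ).star
  simp only [RCLike.star_def, inner_conj_symm, hU _ φ χ] at left
  exact left.unique (h'.hasDerivAt φ χ δ)

theorem isFormalAdjoint_pow (h : IsWeakFlow ι J U) (h' : IsWeakFlow ι J' U')
    (hU : ∀ δ, IsFormalAdjoint ι (U δ) (U' δ)) (j : ℕ) :
    IsFormalAdjoint ι (ι ∘L J ^ j) (ι ∘L J' ^ j) := by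
  refine IsFormalAdjoint.pow ?_ j
  simpa only [h.zero, h'.zero] using h.isFormalAdjoint_comp h' hU 0

theorem isFormalAdjoint_taylorRem (h : IsWeakFlow ι J U) (h' : IsWeakFlow ι J' U')
    (hU : ∀ δ, IsFormalAdjoint ι (U δ) (U' δ)) (k : ℕ) (δ : ℝ) :
    IsFormalAdjoint ι (taylorRem ι J U k δ) (taylorRem ι J' U' k δ) :=
  (hU δ).sub <| .sum fun j _ => (h.isFormalAdjoint_pow h' hU j).real_smul _

theorem isFormalAdjoint_taylorRem_comp (h : IsWeakFlow ι J U) (h' : IsWeakFlow ι J' U')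
    (hU : ∀ δ, IsFormalAdjoint ι (U δ) (U' δ)) (k : ℕ) (δ : ℝ) :
    IsFormalAdjoint ι (taylorRem ι J U k δ ∘L J) (taylorRem ι J' U' k δ ∘L J') := by
  simp only [taylorRem, ContinuousLinearMap.sub_comp, ContinuousLinearMap.finsetSum_comp,
    ContinuousLinearMap.smul_comp]
  refine (h.isFormalAdjoint_comp h' hU δ).sub (.sum fun j _ => ?_)
  have key := (h.isFormalAdjoint_pow h' hU (j + 1)).real_smul (δ ^ j / j.factorial)
  rwa [pow_succ J, pow_succ J'] at key

end IsWeakFlow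

end Core

theorem injective_schIncl : Function.Injective schIncl := SchwartzMap.injective_toLp 2 volume

theorem denseRange_schIncl : DenseRange schIncl :=
  SchwartzMap.denseRange_toLpCLM ENNReal.ofNat_ne_top

theorem schIncl_ae (φ : Sch) : schIncl φ =ᵐ[volume] φ := φ.coeFn_toLp 2 volume

theorem inner_schIncl_left (χ : Sch) (ψ : Hf) :
    inner ℂ (schIncl χ) ψ = ∫ x, starRingEnd ℂ (χ x) * ψ x := by
  rw [L2.inner_def]
  refine integral_congr_ae ?_
  filter_upwards [schIncl_ae χ] with x hx
  rw [hx, RCLike.inner_apply']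

theorem inner_schIncl_of_ae {χ : Sch} {ψ : Hf} {f : ℝ → ℂ} (h : ψ =ᵐ[volume] f) :
    inner ℂ (schIncl χ) ψ = ∫ x, starRingEnd ℂ (χ x) * f x := by
  rw [inner_schIncl_left]
  exact integral_congr_ae (h.mono fun x hx => congrArg (starRingEnd ℂ (χ x) * ·) hx)

theorem integrable_conj_mul (f g : Sch) : Integrable fun x => starRingEnd ℂ (f x) * g x :=
  (SchwartzMap.pairing ((ContinuousLinearMap.mul ℝ ℂ).comp
    (Complex.conjCLE : ℂ →L[ℝ] ℂ)) f g).integrable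

namespace BlochLandau

theorem Q_apply (φ : Sch) (x : ℝ) : Q φ x = x * φ x :=
  SchwartzMap.smulLeftCLM_apply_apply Complex.ofRealCLM.hasTemperateGrowth φ x

theorem isFormalAdjoint_Q : IsFormalAdjoint schIncl (schIncl ∘L Q) (schIncl ∘L Q) := fun φ χ => by
  simp only [ContinuousLinearMap.comp_apply, inner_schIncl_of_ae (schIncl_ae _), Q_apply, map_mul,
    Complex.conj_ofReal]
  exact integral_congr_ae (.of_forall fun x => by ring)

theorem isFormalAdjoint_deriv : IsFormalAdjoint schIncl (schIncl ∘L SchwartzMap.derivCLM ℂ ℂ)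
    (-(schIncl ∘L SchwartzMap.derivCLM ℂ ℂ)) := fun φ χ => by
  have by_parts := integral_bilinear_hasDerivAt_right_eq_neg_left_of_integrable
    (L := ContinuousLinearMap.mul ℝ ℂ) (u := fun x => starRingEnd ℂ (φ x)) (v := χ)
    (fun x _ => (φ.hasDerivAt x).star) (fun x _ => χ.hasDerivAt x)
    (integrable_conj_mul φ (SchwartzMap.derivCLM ℂ ℂ χ))
    (integrable_conj_mul (SchwartzMap.derivCLM ℂ ℂ φ) χ) (integrable_conj_mul φ χ)
  simp only [ContinuousLinearMap.mul_apply', RCLike.star_def] at by_parts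
  simp only [neg_apply, inner_neg_right, ContinuousLinearMap.comp_apply,
    inner_schIncl_of_ae (schIncl_ae _), SchwartzMap.derivCLM_apply, by_parts, neg_neg]

end BlochLandau

open BlochLandau (Q)

/-! ### Weyl operators -/

/-- The pointwise expression of `weyl ι u v φ` for a continuous function `φ`. -/
def weylFun (ι u v : ℝ) (φ : ℝ → ℂ) (x : ℝ) : ℂ :=
  Complex.exp (Complex.I * (ι * u * v / 2 : ℝ)) *
    (Complex.exp (Complex.I * (v * x : ℝ)) * φ (x + ι * u))

/-- The generator `i (u P + v Q)` of the one-parameter group `δ ↦ weyl ι (δ u) (δ v)`, where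
`P = -i ι d/dx`. -/
def weylGen (ι u v : ℝ) : Sch →L[ℂ] Sch :=
  ((ι * u : ℝ) : ℂ) • SchwartzMap.derivCLM ℂ ℂ + (Complex.I * v) • Q

theorem phaseMul_ae (v : ℝ) (ψ : Hf) :
    phaseMul v ψ =ᵐ[volume] fun x => Complex.exp (Complex.I * (v * x : ℝ)) * ψ x := by
  have norm_eq (x : ℝ) : ‖Complex.exp (Complex.I * (v * x : ℝ)) * ψ x‖ = ‖ψ x‖ := by
    rw [norm_mul, mul_comm Complex.I, Complex.norm_exp_ofReal_mul_I, one_mul]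
  have continuous : Continuous fun x : ℝ => Complex.exp (Complex.I * (v * x : ℝ)) := by fun_prop
  exact MemLp.coeFn_toLp ((Lp.memLp ψ).of_le
    (continuous.aestronglyMeasurable.mul (Lp.aestronglyMeasurable ψ))
    (.of_forall fun x => (norm_eq x).le))

theorem weyl_schIncl_ae (ι u v : ℝ) (φ : Sch) :
    weyl ι u v (schIncl φ) =ᵐ[volume] weylFun ι u v φ := by
  have mp := measurePreserving_add_right volume (ι * u)
  have shift_ae : shift (ι * u) (schIncl φ) =ᵐ[volume] schIncl φ ∘ fun x => x + ι * u :=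
    Lp.coeFn_compMeasurePreserving _ mp
  filter_upwards [shift_ae, mp.quasiMeasurePreserving.ae_eq_comp (schIncl_ae φ),
    phaseMul_ae v (shift (ι * u) (schIncl φ)),
    Lp.coeFn_smul (Complex.exp (Complex.I * (ι * u * v / 2 : ℝ)))
      (phaseMul v (shift (ι * u) (schIncl φ)))] with x h₁ h₂ h₃ h₄
  refine h₄.trans ?_
  rw [Pi.smul_apply, h₃, h₁, h₂]
  rfl

theorem norm_weyl_apply (ι u v : ℝ) (ψ : Hf) : ‖weyl ι u v ψ‖ = ‖ψ‖ := by
  rw [weyl, smul_apply, norm_smul, mul_comm Complex.I, Complex.norm_exp_ofReal_mul_I, one_mul]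
  exact ((phaseMul v).norm_map _).trans ((shift (ι * u)).norm_map ψ)

theorem inner_weyl_schIncl (ι u v : ℝ) (χ φ : Sch) :
    inner ℂ (schIncl χ) (weyl ι u v (schIncl φ)) = ∫ x, starRingEnd ℂ (χ x) * weylFun ι u v φ x :=
  inner_schIncl_of_ae (weyl_schIncl_ae ι u v φ)

theorem weylFun_adjoint (ι u v : ℝ) (φ χ : ℝ → ℂ) (x : ℝ) :
    φ (x + ι * u) * starRingEnd ℂ (weylFun ι (-u) (-v) χ (x + ι * u))
      = starRingEnd ℂ (χ x) * weylFun ι u v φ x := by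
  have phases : Complex.exp (-Complex.I * (ι * -u * -v / 2 : ℝ)) *
        Complex.exp (-Complex.I * (-v * (x + ι * u) : ℝ))
      = Complex.exp (Complex.I * (ι * u * v / 2 : ℝ)) * Complex.exp (Complex.I * (v * x : ℝ)) := by
    rw [← Complex.exp_add, ← Complex.exp_add]
    congr 1
    push_cast
    ring
  simp only [weylFun, map_mul, ← Complex.exp_conj, Complex.conj_I, Complex.conj_ofReal,
    show x + ι * u + ι * -u = x by ring]
  linear_combination φ (x + ι * u) * starRingEnd ℂ (χ x) * phases

theorem isFormalAdjoint_weyl (ι u v : ℝ) :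
    IsFormalAdjoint schIncl (weyl ι u v ∘L schIncl) (weyl ι (-u) (-v) ∘L schIncl) :=
  IsFormalAdjoint.symm fun χ φ => by
    simp only [ContinuousLinearMap.comp_apply]
    rw [← inner_conj_symm, inner_weyl_schIncl, inner_weyl_schIncl, ← integral_conj,
      ← integral_add_right_eq_self _ (ι * u)]
    refine integral_congr_ae (.of_forall fun x => ?_)
    simp only [map_mul, Complex.conj_conj, weylFun_adjoint]

theorem hasDerivAt_weylFun (ι u v : ℝ) (φ : Sch) (δ x : ℝ) :
    HasDerivAt (fun δ => weylFun ι (δ * u) (δ * v) φ x)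
      (weylFun ι (δ * u) (δ * v) (weylGen ι u v φ) x) δ := by
  have translation : HasDerivAt (fun δ : ℝ => x + ι * (δ * u)) (ι * (1 * u)) δ :=
    (((hasDerivAt_id δ).mul_const u).const_mul ι).const_add x
  have character : HasDerivAt (fun δ : ℝ => Complex.I * (δ * v * x : ℝ))
      (Complex.I * (1 * v * x : ℝ)) δ :=
    (((hasDerivAt_id δ).mul_const v).mul_const x).ofReal_comp.const_mul Complex.I
  have cocycle : HasDerivAt (fun δ : ℝ => Complex.I * (ι * (δ * u) * (δ * v) / 2 : ℝ))
      (Complex.I * (ι * (1 * u) * (δ * v) + ι * (δ * u) * (1 * v) : ℝ) / 2) δ := by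
    have := ((((hasDerivAt_id δ).mul_const u).const_mul ι).mul ((hasDerivAt_id δ).mul_const v)
      |>.div_const 2).ofReal_comp.const_mul Complex.I
    refine this.congr_deriv ?_
    push_cast
    simp only [id]
    ring
  have translated := (φ.hasDerivAt _).scomp δ translation
  refine (cocycle.cexp.mul (character.cexp.mul translated)).congr_deriv ?_
  simp only [weylFun, weylGen, smul_apply, add_apply, BlochLandau.Q_apply,
    SchwartzMap.derivCLM_apply, Function.comp_apply, Pi.mul_apply, smul_eq_mul, Complex.real_smul]
  push_cast
  ring

theorem norm_weylFun (ι u v : ℝ) (φ : ℝ → ℂ) (x : ℝ) : ‖weylFun ι u v φ x‖ = ‖φ (x + ι * u)‖ := by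
  simp only [weylFun, norm_mul, mul_comm Complex.I, Complex.norm_exp_ofReal_mul_I, one_mul]

theorem continuous_weylFun (ι u v : ℝ) {φ : ℝ → ℂ} (hφ : Continuous φ) :
    Continuous (weylFun ι u v φ) := by
  unfold weylFun
  fun_prop

theorem hasDerivAt_inner_weyl (ι u v : ℝ) (χ φ : Sch) (δ : ℝ) :
    HasDerivAt (fun δ => inner ℂ (schIncl χ) (weyl ι (δ * u) (δ * v) (schIncl φ)))
      (inner ℂ (schIncl χ) (weyl ι (δ * u) (δ * v) (schIncl (weylGen ι u v φ)))) δ := by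
  simp only [inner_weyl_schIncl]
  have bound (φ : Sch) (δ x : ℝ) : ‖starRingEnd ℂ (χ x) * weylFun ι (δ * u) (δ * v) φ x‖
      ≤ ‖χ x‖ * SchwartzMap.seminorm ℝ 0 0 φ := by
    rw [norm_mul, RCLike.norm_conj, norm_weylFun]
    exact mul_le_mul_of_nonneg_left (SchwartzMap.norm_le_seminorm ℝ φ _) (norm_nonneg _)
  have measurable (φ : Sch) (δ : ℝ) :
      AEStronglyMeasurable fun x => starRingEnd ℂ (χ x) * weylFun ι (δ * u) (δ * v) φ x :=
    ((Complex.continuous_conj.comp χ.continuous).mul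
      (continuous_weylFun ι (δ * u) (δ * v) φ.continuous)).aestronglyMeasurable
  have integrable (C : ℝ) : Integrable fun x => ‖χ x‖ * C := χ.integrable.norm.mul_const C
  exact (hasDerivAt_integral_of_dominated_loc_of_deriv_le Filter.univ_mem
    (.of_forall (measurable φ)) ((integrable _).mono' (measurable φ δ) (.of_forall (bound φ δ)))
    (measurable _ δ) (.of_forall fun x δ _ => bound _ δ x) (integrable _)
    (.of_forall fun x δ _ => (hasDerivAt_weylFun ι u v φ δ x).const_mul _)).2

theorem weyl_zero_schIncl (ι : ℝ) (φ : Sch) : weyl ι 0 0 (schIncl φ) = schIncl φ := by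
  refine Lp.ext ((weyl_schIncl_ae ι 0 0 φ).trans (Filter.EventuallyEq.trans ?_ (schIncl_ae φ).symm))
  exact .of_forall fun x => by simp [weylFun]

theorem isWeakFlow_weyl (ι u v : ℝ) :
    IsWeakFlow schIncl (weylGen ι u v) fun δ => weyl ι (δ * u) (δ * v) ∘L schIncl where
  zero := by
    ext1 φ
    simpa using weyl_zero_schIncl ι φ
  norm_le δ φ := (norm_weyl_apply _ _ _ _).le
  hasDerivAt := hasDerivAt_inner_weyl ι u v

/-! ### Ladder operators -/

section Ladder

variable {D H : Type*} [AddCommGroup D] [Module ℂ D] [TopologicalSpace D]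
  [NormedAddCommGroup H] [InnerProductSpace ℂ H] {ι : D →L[ℂ] H} {A A' : D →L[ℂ] D}

/-- On the core `D`, the operators `A` and `A'` are formally adjoint and satisfy the canonical
commutation relation `[A, A'] = 1` of an annihilation and a creation operator. -/
structure IsLadderPair (ι : D →L[ℂ] H) (A A' : D →L[ℂ] D) : Prop where
  adjoint : IsFormalAdjoint ι (ι ∘L A) (ι ∘L A')
  comm : ∀ φ, A (A' φ) = A' (A φ) + φ

namespace IsLadderPair

theorem norm_sq_number_add (h : IsLadderPair ι A A') (t : ℝ) (φ : D) :
    ‖ι (A' (A φ) + (t : ℂ) • φ)‖ ^ 2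
      = ‖ι (A' (A φ))‖ ^ 2 + 2 * t * ‖ι (A φ)‖ ^ 2 + t ^ 2 * ‖ι φ‖ ^ 2 := by
  have cross : inner ℂ (ι (A' (A φ))) (ι φ) = ((‖ι (A φ)‖ ^ 2 : ℝ) : ℂ) := by
    rw [Complex.ofReal_pow]
    exact (h.adjoint.symm (A φ) φ).trans (inner_self_eq_norm_sq_to_K _)
  rw [map_add, map_smul, norm_add_sq (𝕜 := ℂ), inner_smul_right, cross, ← Complex.ofReal_mul,
    norm_smul, Complex.norm_real, mul_pow, Real.norm_eq_abs, sq_abs]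
  simp only [RCLike.re_to_complex, Complex.ofReal_re]
  ring

theorem norm_sq_creation (h : IsLadderPair ι A A') (φ : D) :
    ‖ι (A' φ)‖ ^ 2 = ‖ι (A φ)‖ ^ 2 + ‖ι φ‖ ^ 2 := by
  have key : inner ℂ (ι (A' φ)) (ι (A' φ)) = inner ℂ (ι (A φ)) (ι (A φ)) + inner ℂ (ι φ) (ι φ) := by
    have e₁ := h.adjoint.symm φ (A' φ)
    have e₂ := h.adjoint φ (A φ)
    simp only [ContinuousLinearMap.comp_apply] at e₁ e₂
    rw [e₁, e₂, h.comm, map_add, inner_add_right]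
  simp only [inner_self_eq_norm_sq_to_K] at key
  exact_mod_cast key

theorem norm_word_le (h : IsLadderPair ι A A') (φ : D) {w : D}
    (hw : w = φ ∨ w = A φ ∨ w = A' φ ∨
      w = A (A φ) ∨ w = A (A' φ) ∨ w = A' (A φ) ∨ w = A' (A' φ)) :
    ‖ι w‖ ≤ 3 * ‖ι (A' (A φ) + ((1 / 2 : ℝ) : ℂ) • φ)‖ := by
  have osc := h.norm_sq_number_add (1 / 2) φ
  have number := h.norm_sq_creation (A φ)
  have anti : ‖ι (A (A' φ))‖ ^ 2 = ‖ι (A' (A φ))‖ ^ 2 + 2 * ‖ι (A φ)‖ ^ 2 + ‖ι φ‖ ^ 2 := by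
    simpa [← h.comm] using h.norm_sq_number_add 1 φ
  refine le_of_sq_le_sq ?_ (by positivity)
  rw [mul_pow, osc]
  rcases hw with hw | hw | hw | hw | hw | hw | hw <;> rw [hw] <;>
  nlinarith [h.norm_sq_creation φ, h.norm_sq_creation (A' φ), sq_nonneg ‖ι φ‖,
    sq_nonneg ‖ι (A φ)‖, sq_nonneg ‖ι (A (A φ))‖]

theorem norm_linear_le (h : IsLadderPair ι A A') (φ : D) (α β : ℂ) :
    ‖ι (α • A φ + β • A' φ)‖
      ≤ 3 * (‖α‖ + ‖β‖) * ‖ι (A' (A φ) + ((1 / 2 : ℝ) : ℂ) • φ)‖ := by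
  rw [map_add, map_smul, map_smul]
  refine (norm_add_le _ _).trans ?_
  rw [norm_smul, norm_smul]
  calc _ ≤ ‖α‖ * (3 * ‖ι (A' (A φ) + ((1 / 2 : ℝ) : ℂ) • φ)‖)
      + ‖β‖ * (3 * ‖ι (A' (A φ) + ((1 / 2 : ℝ) : ℂ) • φ)‖) := by
        gcongr <;> exact h.norm_word_le φ (by simp)
    _ = _ := by ring

theorem norm_quadratic_le (h : IsLadderPair ι A A') (φ : D) (α β α' β' : ℂ) :
    ‖ι (α • A (α' • A φ + β' • A' φ) + β • A' (α' • A φ + β' • A' φ))‖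
      ≤ 3 * ((‖α‖ + ‖β‖) * (‖α'‖ + ‖β'‖)) * ‖ι (A' (A φ) + ((1 / 2 : ℝ) : ℂ) • φ)‖ := by
  set N := ‖ι (A' (A φ) + ((1 / 2 : ℝ) : ℂ) • φ)‖
  simp only [map_add, map_smul, smul_add, smul_smul]
  refine ((norm_add_le _ _).trans (add_le_add (norm_add_le _ _) (norm_add_le _ _))).trans ?_
  simp only [norm_smul, norm_mul]
  calc _ ≤ ‖α‖ * ‖α'‖ * (3 * N) + ‖α‖ * ‖β'‖ * (3 * N)
      + (‖β‖ * ‖α'‖ * (3 * N) + ‖β‖ * ‖β'‖ * (3 * N)) := by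
        gcongr <;> exact h.norm_word_le φ (by simp)
    _ = _ := by ring

end IsLadderPair

end Ladder

/-! ### The oscillator `Ξ` -/

namespace BlochLandau

variable (M : BlochLandau)

theorem lattice_mul_conj (v w : Plane) :
    (v 0 - Complex.I * v 1) / (Real.sqrt M.area : ℂ)
        * starRingEnd ℂ ((w 0 - Complex.I * w 1) / (Real.sqrt M.area : ℂ))
      = (inner ℝ v w + Complex.I * (v 0 * w 1 - v 1 * w 0)) / M.area := by
  have hsq : (Real.sqrt M.area : ℂ) * Real.sqrt M.area = M.area := by
    rw [← Complex.ofReal_mul, Real.mul_self_sqrt (show 0 ≤ M.area from M.area_pos.le)]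
  simp only [map_div₀, map_sub, map_mul, Complex.conj_I, Complex.conj_ofReal, div_mul_div_comm,
    hsq, PiLp.inner_apply, Fin.sum_univ_two, RCLike.inner_apply, conj_trivial]
  congr 1
  push_cast
  linear_combination (-(v 1 : ℂ) * w 1) * Complex.I_sq

theorem area_ne_zero : (M.area : ℂ) ≠ 0 :=
  Complex.ofReal_ne_zero.2 M.area_pos.ne'

theorem za_mul_conj_za : M.za * starRingEnd ℂ M.za = ((‖M.a‖ ^ 2 : ℝ) : ℂ) / M.area := by
  rw [za, lattice_mul_conj, real_inner_self_eq_norm_sq]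
  ring

theorem zb_mul_conj_zb : M.zb * starRingEnd ℂ M.zb = ((‖M.b‖ ^ 2 : ℝ) : ℂ) / M.area := by
  rw [zb, lattice_mul_conj, real_inner_self_eq_norm_sq]
  ring

theorem za_mul_conj_zb :
    M.za * starRingEnd ℂ M.zb = (inner ℝ M.a M.b : ℝ) / M.area + Complex.I := by
  rw [za, zb, lattice_mul_conj, div_add' _ _ _ M.area_ne_zero]
  congr 2
  rw [area]
  push_cast
  ring

theorem zb_mul_conj_za :
    M.zb * starRingEnd ℂ M.za = (inner ℝ M.a M.b : ℝ) / M.area - Complex.I := by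
  simpa [mul_comm, sub_eq_add_neg] using congrArg (starRingEnd ℂ) M.za_mul_conj_zb

theorem sqrt_two_mul_self : (Real.sqrt 2 : ℂ) * Real.sqrt 2 = 2 := by
  exact_mod_cast Real.mul_self_sqrt zero_le_two

theorem P_apply (φ : Sch) (x : ℝ) : M.P φ x = -(Complex.I * M.sgn) * deriv φ x := by
  simp only [P, smul_apply, SchwartzMap.derivCLM_apply, smul_eq_mul]

theorem Q_P_apply (φ : Sch) (x : ℝ) : Q (M.P φ) x = M.P (Q φ) x + Complex.I * M.sgn * φ x := by
  have hderiv : HasDerivAt (fun x : ℝ => (x : ℂ) * φ x) (1 * φ x + x * deriv φ x) x :=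
    (HasDerivAt.ofReal_comp (hasDerivAt_id x)).mul (φ.hasDerivAt x)
  have hQ : (Q φ : ℝ → ℂ) = fun x : ℝ => (x : ℂ) * φ x := funext (Q_apply φ)
  simp only [Q_apply, P_apply, hQ, hderiv.deriv]
  ring

theorem ladder_coef_mul : (-Complex.I / (Real.sqrt 2 : ℂ)) * (Complex.I / (Real.sqrt 2 : ℂ))
    = 1 / 2 := by
  rw [div_mul_div_comm, sqrt_two_mul_self, neg_mul, Complex.I_mul_I, neg_neg]

theorem aDag_aOp (φ : Sch) : M.aDag (M.aOp φ) = M.xiSch φ - ((M.sgn : ℂ) / 2) • φ := by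
  ext x
  have half : (1 / (2 * M.area) : ℝ) = (1 / 2 / M.area : ℂ) := by
    push_cast
    rw [div_div]
  simp only [aDag, aOp, xiSch, sub_apply, add_apply, smul_apply, map_sub, map_smul, smul_eq_mul,
    ContinuousLinearMap.comp_apply, Q_P_apply, half]
  linear_combination (M.za * starRingEnd ℂ M.za * M.P (M.P φ) x
      - M.za * starRingEnd ℂ M.zb * M.P (Q φ) x
      - M.zb * starRingEnd ℂ M.za * (M.P (Q φ) x + Complex.I * M.sgn * φ x)
      + M.zb * starRingEnd ℂ M.zb * Q (Q φ) x) * ladder_coef_mul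
    + (1 / 2 * M.P (M.P φ) x) * M.za_mul_conj_za + (1 / 2 * Q (Q φ) x) * M.zb_mul_conj_zb
    - (1 / 2 * M.P (Q φ) x) * M.za_mul_conj_zb
    - (1 / 2 * (M.P (Q φ) x + Complex.I * M.sgn * φ x)) * M.zb_mul_conj_za
    + (1 / 2 * M.sgn * φ x) * Complex.I_sq

theorem aOp_aDag (φ : Sch) : M.aOp (M.aDag φ) = M.aDag (M.aOp φ) + (M.sgn : ℂ) • φ := by
  ext x
  simp only [aDag, aOp, sub_apply, add_apply, smul_apply, map_sub, map_smul, smul_eq_mul,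
    Q_P_apply]
  linear_combination (Complex.I * M.sgn * φ x *
      (M.zb * starRingEnd ℂ M.za - M.za * starRingEnd ℂ M.zb)) * ladder_coef_mul
    + (1 / 2 * Complex.I * M.sgn * φ x) * (M.zb_mul_conj_za - M.za_mul_conj_zb)
    - (M.sgn * φ x) * Complex.I_sq

/-- The linear combination `u Q + v P` of the canonical operators. -/
def linSch (u v : ℂ) : Sch →L[ℂ] Sch := u • Q + v • M.P

theorem isFormalAdjoint_P : IsFormalAdjoint schIncl (schIncl ∘L M.P) (schIncl ∘L M.P) := by
  have key := isFormalAdjoint_deriv.smul (-(Complex.I * M.sgn))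
  simpa [P, ContinuousLinearMap.comp_smul] using key

theorem isFormalAdjoint_linSch (u v : ℂ) : IsFormalAdjoint schIncl (schIncl ∘L M.linSch u v)
    (schIncl ∘L M.linSch (starRingEnd ℂ u) (starRingEnd ℂ v)) := by
  simpa only [linSch, ContinuousLinearMap.comp_add, ContinuousLinearMap.comp_smul] using
    (isFormalAdjoint_Q.smul u).add (M.isFormalAdjoint_P.smul v)

theorem weylGen_sgn (u v : ℝ) :
    weylGen M.sgn u v = M.linSch (Complex.I * v) (Complex.I * u) := by
  ext φ x
  simp only [weylGen, linSch, add_apply, smul_apply, P_apply, SchwartzMap.derivCLM_apply,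
    smul_eq_mul, Complex.ofReal_mul]
  linear_combination (M.sgn * u * deriv φ x : ℂ) * Complex.I_sq

theorem aOp_eq_linSch : M.aOp = M.linSch (-(Complex.I / Real.sqrt 2 * starRingEnd ℂ M.zb))
    (Complex.I / Real.sqrt 2 * starRingEnd ℂ M.za) := by
  rw [aOp, linSch]
  module

theorem aDag_eq_linSch : M.aDag = M.linSch (Complex.I / Real.sqrt 2 * M.zb)
    (-(Complex.I / Real.sqrt 2 * M.za)) := by
  rw [aDag, linSch]
  module

theorem isFormalAdjoint_aOp : IsFormalAdjoint schIncl (schIncl ∘L M.aOp) (schIncl ∘L M.aDag) := by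
  rw [aOp_eq_linSch, aDag_eq_linSch]
  simpa [neg_div] using M.isFormalAdjoint_linSch (-(Complex.I / Real.sqrt 2 * starRingEnd ℂ M.zb))
    (Complex.I / Real.sqrt 2 * starRingEnd ℂ M.za)

theorem linSch_eq_ladder (u v : ℂ) : M.linSch u v = ((u * M.za + v * M.zb) / Real.sqrt 2) • M.aOp
    + ((u * starRingEnd ℂ M.za + v * starRingEnd ℂ M.zb) / Real.sqrt 2) • M.aDag := by
  have commutator : M.za * starRingEnd ℂ M.zb - M.zb * starRingEnd ℂ M.za = 2 * Complex.I := by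
    linear_combination M.za_mul_conj_zb - M.zb_mul_conj_za
  have half : (Real.sqrt 2 : ℂ)⁻¹ ^ 2 = 1 / 2 := by
    rw [inv_pow, sq, sqrt_two_mul_self, one_div]
  ext φ x
  simp only [linSch, aOp, aDag, add_apply, sub_apply, smul_apply, smul_eq_mul]
  linear_combination (u * Q φ x + v * M.P φ x) *
    (Complex.I * (M.za * starRingEnd ℂ M.zb - M.zb * starRingEnd ℂ M.za) * half
      + Complex.I / 2 * commutator + Complex.I_sq)

/-- The annihilation operator, the formal adjoint of `creation`. -/
def annihilation : Sch →L[ℂ] Sch := if 0 < M.q then M.aOp else M.aDag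

theorem isLadderPair : IsLadderPair schIncl M.annihilation M.creation := by
  rw [annihilation, creation]
  split_ifs with hq
  · exact ⟨M.isFormalAdjoint_aOp, fun φ => by simp [aOp_aDag, sgn, hq]⟩
  · exact ⟨M.isFormalAdjoint_aOp.symm, fun φ => by simp [aOp_aDag, sgn, hq]⟩

theorem creation_annihilation_add_half (φ : Sch) :
    M.creation (M.annihilation φ) + ((1 / 2 : ℝ) : ℂ) • φ = M.xiSch φ := by
  rw [annihilation, creation]
  split_ifs with hq
  · simp only [aDag_aOp, sgn, hq, if_true]
    push_cast
    module
  · simp only [aOp_aDag, aDag_aOp, sgn, hq, if_false]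
    push_cast
    module

/-- A constant of the oscillator `Ξ`, bounding the ladder coefficients of `u Q + v P` in terms
of `‖u‖ + ‖v‖`. -/
def ladderBound : ℝ := 2 * (‖M.za‖ + ‖M.zb‖)

theorem ladderBound_nonneg : 0 ≤ M.ladderBound := by
  unfold ladderBound
  positivity

theorem norm_ladder_coef_le (u v z w : ℂ) :
    ‖(u * z + v * w) / Real.sqrt 2‖ ≤ (‖z‖ + ‖w‖) * (‖u‖ + ‖v‖) := by
  have one_le : 1 ≤ ‖(Real.sqrt 2 : ℂ)‖ := by
    rw [Complex.norm_real, Real.norm_of_nonneg (Real.sqrt_nonneg 2)]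
    exact Real.one_le_sqrt.2 one_le_two
  calc ‖(u * z + v * w) / Real.sqrt 2‖ ≤ ‖u * z + v * w‖ := by
        rw [norm_div]
        exact div_le_self (norm_nonneg _) one_le
    _ ≤ ‖u‖ * ‖z‖ + ‖v‖ * ‖w‖ := by
        simpa only [norm_mul] using norm_add_le (u * z) (v * w)
    _ ≤ (‖z‖ + ‖w‖) * (‖u‖ + ‖v‖) := by
        nlinarith [mul_nonneg (norm_nonneg u) (norm_nonneg w),
          mul_nonneg (norm_nonneg v) (norm_nonneg z)]

theorem exists_linSch_eq_ladder (u v : ℂ) : ∃ α β : ℂ,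
    M.linSch u v = α • M.annihilation + β • M.creation ∧
      ‖α‖ + ‖β‖ ≤ M.ladderBound * (‖u‖ + ‖v‖) := by
  have bound := add_le_add (norm_ladder_coef_le u v M.za M.zb)
    (norm_ladder_coef_le u v (starRingEnd ℂ M.za) (starRingEnd ℂ M.zb))
  rw [RCLike.norm_conj, RCLike.norm_conj, ← two_mul, ← mul_assoc] at bound
  rw [linSch_eq_ladder, annihilation, creation]
  split_ifs with hq
  · exact ⟨_, _, rfl, bound⟩
  · exact ⟨_, _, add_comm _ _, (add_comm _ _).trans_le bound⟩

theorem norm_schIncl_le_xi (φ : Sch) : ‖schIncl φ‖ ≤ 3 * ‖schIncl (M.xiSch φ)‖ := by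
  rw [← creation_annihilation_add_half]
  exact M.isLadderPair.norm_word_le φ (Or.inl rfl)

theorem norm_linSch_le_xi (u v : ℂ) (φ : Sch) : ‖schIncl (M.linSch u v φ)‖
    ≤ 3 * (M.ladderBound * (‖u‖ + ‖v‖)) * ‖schIncl (M.xiSch φ)‖ := by
  obtain ⟨α, β, hlin, hle⟩ := M.exists_linSch_eq_ladder u v
  rw [hlin, ← creation_annihilation_add_half]
  exact (M.isLadderPair.norm_linear_le φ α β).trans (by gcongr)

theorem norm_linSch_linSch_le_xi (u v u' v' : ℂ) (φ : Sch) :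
    ‖schIncl (M.linSch u v (M.linSch u' v' φ))‖
      ≤ 3 * (M.ladderBound * (‖u‖ + ‖v‖) * (M.ladderBound * (‖u'‖ + ‖v'‖)))
        * ‖schIncl (M.xiSch φ)‖ := by
  obtain ⟨α, β, hlin, hle⟩ := M.exists_linSch_eq_ladder u v
  obtain ⟨α', β', hlin', hle'⟩ := M.exists_linSch_eq_ladder u' v'
  rw [hlin, hlin', ← creation_annihilation_add_half]
  have nonneg := M.ladderBound_nonneg
  exact (M.isLadderPair.norm_quadratic_le φ α β α' β').trans (by gcongr)

theorem isFormalAdjoint_xiSch :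
    IsFormalAdjoint schIncl (schIncl ∘L M.xiSch) (schIncl ∘L M.xiSch) := by
  have number := M.isLadderPair.adjoint.symm.comp M.isLadderPair.adjoint
  have one : IsFormalAdjoint schIncl schIncl schIncl := fun _ _ => rfl
  have xi_eq : schIncl ∘L M.xiSch
      = schIncl ∘L (M.creation ∘L M.annihilation) + ((1 / 2 : ℝ) : ℂ) • schIncl := by
    ext1 φ
    simp only [ContinuousLinearMap.comp_apply, add_apply, smul_apply,
      ← creation_annihilation_add_half, map_add, map_smul]
  rw [xi_eq]
  exact number.add (one.real_smul _)

/-! ### The unitaries `exp (2πiδ I_{n,m})` -/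

theorem iSch_eq_linSch (n : ℤ × ℤ) : M.iSch n = M.linSch (-(n.2 : ℂ)) n.1 := by
  rw [iSch, linSch]
  module

theorem isFormalAdjoint_iSch_pow (n : ℤ × ℤ) (j : ℕ) :
    IsFormalAdjoint schIncl (schIncl ∘L M.iSch n ^ j) (schIncl ∘L M.iSch n ^ j) := by
  refine IsFormalAdjoint.pow ?_ j
  simpa [iSch_eq_linSch] using M.isFormalAdjoint_linSch (-(n.2 : ℂ)) n.1

/-- The generator `2πi I_{n,m}` of `δ ↦ exp (2πiδ I_{n,m})`. -/
def jSch (n : ℤ × ℤ) : Sch →L[ℂ] Sch := (2 * Real.pi * Complex.I) • M.iSch n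

/-- The unitary `exp (2πiδ I_{n,m})` on Schwartz functions. -/
def expSch (n : ℤ × ℤ) (δ : ℝ) : Sch →L[ℂ] Hf := M.expI δ n ∘L schIncl

theorem jSch_eq_weylGen (n : ℤ × ℤ) :
    M.jSch n = weylGen M.sgn (2 * Real.pi * n.1) (-(2 * Real.pi * n.2)) := by
  rw [weylGen_sgn, jSch, iSch, linSch]
  push_cast
  module

theorem expSch_eq_weyl (n : ℤ × ℤ) (δ : ℝ) : M.expSch n δ
    = weyl M.sgn (δ * (2 * Real.pi * n.1)) (δ * (-(2 * Real.pi * n.2))) ∘L schIncl := by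
  rw [expSch, expI]
  congr 2 <;> ring

theorem isWeakFlow_expSch (n : ℤ × ℤ) : IsWeakFlow schIncl (M.jSch n) (M.expSch n) := by
  rw [jSch_eq_weylGen, funext (M.expSch_eq_weyl n)]
  exact isWeakFlow_weyl _ _ _

theorem isFormalAdjoint_expSch (n : ℤ × ℤ) (δ : ℝ) :
    IsFormalAdjoint schIncl (M.expSch n δ) (M.expSch (-n) δ) := by
  simpa [expSch_eq_weyl] using isFormalAdjoint_weyl M.sgn (δ * (2 * Real.pi * n.1))
    (δ * (-(2 * Real.pi * n.2)))

end BlochLandau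

/-! ### Fourier coefficients of the potentials -/

theorem integral_exp_mul_deriv_of_periodic {g g' : ℝ → ℂ} (c : ℂ) (n : ℤ)
    (hg : ∀ x, HasDerivAt g (g' x) x) (hg' : Continuous g') (h : g 1 = g 0) :
    ∫ x in (0 : ℝ)..1, Complex.exp (-(2 * Real.pi * Complex.I * (c + n * x))) * g' x
      = 2 * Real.pi * Complex.I * n *
        ∫ x in (0 : ℝ)..1, Complex.exp (-(2 * Real.pi * Complex.I * (c + n * x))) * g x := by
  have deriv_exp (x : ℝ) : HasDerivAt
      (fun x : ℝ => Complex.exp (-(2 * Real.pi * Complex.I * (c + n * x))))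
      (Complex.exp (-(2 * Real.pi * Complex.I * (c + n * x))) *
        (-(2 * Real.pi * Complex.I * n))) x := by
    have id_deriv : HasDerivAt (fun x : ℝ => (x : ℂ)) 1 x := (hasDerivAt_id x).ofReal_comp
    simpa using
      (((id_deriv.const_mul (n : ℂ)).const_add c).const_mul (2 * Real.pi * Complex.I)).neg.cexp
  have exp_periodic : Complex.exp (-(2 * Real.pi * Complex.I * (c + n * (1 : ℝ))))
      = Complex.exp (-(2 * Real.pi * Complex.I * (c + n * (0 : ℝ)))) := by
    rw [Complex.exp_eq_exp_iff_exists_int]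
    exact ⟨-n, by push_cast; ring⟩
  rw [intervalIntegral.integral_mul_deriv_eq_deriv_mul (fun x _ => deriv_exp x) (fun x _ => hg x)
    (Continuous.intervalIntegrable (by fun_prop) _ _) (hg'.intervalIntegrable _ _), exp_periodic, h,
    sub_self, zero_sub, ← intervalIntegral.integral_neg, ← intervalIntegral.integral_const_mul]
  refine intervalIntegral.integral_congr fun x _ => ?_
  ring

namespace BlochLandau

variable {M : BlochLandau} {F : Plane → ℝ}

variable (M) in
/-- `F` is smooth and `Γ`-periodic. -/
def SmoothPeriodic (F : Plane → ℝ) : Prop :=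
  ContDiff ℝ ∞ F ∧ ∀ r, F (r + M.a) = F r ∧ F (r + M.b) = F r

theorem SmoothPeriodic.fderiv_apply (hF : M.SmoothPeriodic F) (v : Plane) :
    M.SmoothPeriodic fun r => fderiv ℝ F r v := by
  refine ⟨(hF.1.fderiv_right (m := ∞) (by norm_cast)).clm_apply contDiff_const, fun r => ?_⟩
  have periodic (w : Plane) (hw : ∀ r, F (r + w) = F r) :
      fderiv ℝ F (r + w) v = fderiv ℝ F r v := by
    rw [← fderiv_comp_add_right, funext hw]
  exact ⟨periodic _ fun r => (hF.2 r).1, periodic _ fun r => (hF.2 r).2⟩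

theorem integral_exp_mul_fderiv (hF : ContDiff ℝ ∞ F) {v : Plane} (hv : ∀ r, F (r + v) = F r)
    (c : ℂ) (n : ℤ) (w : Plane) :
    ∫ x in (0 : ℝ)..1, Complex.exp (-(2 * Real.pi * Complex.I * (c + n * x)))
        * (fderiv ℝ F (w + x • v) v : ℂ)
      = 2 * Real.pi * Complex.I * n * ∫ x in (0 : ℝ)..1,
        Complex.exp (-(2 * Real.pi * Complex.I * (c + n * x))) * (F (w + x • v) : ℂ) := by
  refine integral_exp_mul_deriv_of_periodic c n (fun x => ?_) ?_ ?_
  · have line : HasDerivAt (fun x : ℝ => w + x • v) v x := by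
      simpa using ((hasDerivAt_id x).smul_const v).const_add w
    exact ((hF.differentiable (by simp) _).hasFDerivAt.comp_hasDerivAt x line).ofReal_comp
  · have := hF.continuous_fderiv_apply (by simp)
    fun_prop
  · simp [hv]

theorem SmoothPeriodic.fourierCoef_fderiv_b (hF : M.SmoothPeriodic F) (n : ℤ × ℤ) :
    M.fourierCoef (fun r => fderiv ℝ F r M.b) n
      = 2 * Real.pi * Complex.I * n.2 * M.fourierCoef F n := by
  rw [fourierCoef, fourierCoef, ← intervalIntegral.integral_const_mul]
  exact intervalIntegral.integral_congr fun x₁ _ =>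
    integral_exp_mul_fderiv hF.1 (fun r => (hF.2 r).2) (n.1 * x₁) n.2 (x₁ • M.a)

theorem fourierCoef_swap (hF : Continuous F) (n : ℤ × ℤ) :
    M.fourierCoef F n = ∫ x₂ in (0 : ℝ)..1, ∫ x₁ in (0 : ℝ)..1,
      Complex.exp (-(2 * Real.pi * Complex.I * (n.2 * x₂ + n.1 * x₁))) *
        (F (x₂ • M.b + x₁ • M.a) : ℂ) := by
  have integrand : Continuous (Function.uncurry fun x₁ x₂ : ℝ =>
      Complex.exp (-(2 * Real.pi * Complex.I * (n.1 * x₁ + n.2 * x₂))) *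
        (F (x₁ • M.a + x₂ • M.b) : ℂ)) := by
    unfold Function.uncurry
    fun_prop
  rw [fourierCoef, intervalIntegral_intervalIntegral_swap]
  · simp only [add_comm ((n.1 : ℂ) * _), add_comm (_ • M.a)]
  · exact (integrand.continuousOn.integrableOn_compact
      (isCompact_uIcc.prod isCompact_uIcc)).mono_set
        (Set.prod_mono Set.uIoc_subset_uIcc Set.uIoc_subset_uIcc)

theorem SmoothPeriodic.fourierCoef_fderiv_a (hF : M.SmoothPeriodic F) (n : ℤ × ℤ) :
    M.fourierCoef (fun r => fderiv ℝ F r M.a) n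
      = 2 * Real.pi * Complex.I * n.1 * M.fourierCoef F n := by
  rw [fourierCoef_swap (hF.fderiv_apply M.a).1.continuous, fourierCoef_swap hF.1.continuous,
    ← intervalIntegral.integral_const_mul]
  exact intervalIntegral.integral_congr fun x₂ _ =>
    integral_exp_mul_fderiv hF.1 (fun r => (hF.2 r).1) (n.2 * x₂) n.1 (x₂ • M.b)

theorem fourierCoef_conj (F : Plane → ℝ) (n : ℤ × ℤ) :
    starRingEnd ℂ (M.fourierCoef F n) = M.fourierCoef F (-n) := by
  simp only [fourierCoef, ← intervalIntegral.intervalIntegral_conj]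
  refine intervalIntegral.integral_congr fun x₁ _ => intervalIntegral.integral_congr fun x₂ _ => ?_
  simp only [map_mul, ← Complex.exp_conj, Complex.conj_ofReal, map_neg, map_add, Complex.conj_I,
    Complex.conj_ofNat, map_intCast, Prod.fst_neg, Prod.snd_neg]
  congr 2
  push_cast
  ring

theorem exists_norm_fourierCoef_le (hF : Continuous F) : ∃ C : ℝ, ∀ n, ‖M.fourierCoef F n‖ ≤ C := by
  have cell : Continuous fun y : ℝ × ℝ => F (y.1 • M.a + y.2 • M.b) := by fun_prop
  obtain ⟨C, hC⟩ := (isCompact_Icc (a := (0 : ℝ)) (b := 1)).prod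
    (isCompact_Icc (a := (0 : ℝ)) (b := 1)) |>.exists_bound_of_continuousOn cell.continuousOn
  refine ⟨C, fun n => ?_⟩
  have of_norm_le {f : ℝ → ℂ} (hf : ∀ x ∈ Set.Icc (0 : ℝ) 1, ‖f x‖ ≤ C) :
      ‖∫ x in (0 : ℝ)..1, f x‖ ≤ C := by
    simpa using intervalIntegral.norm_integral_le_of_norm_le_const (a := 0) (b := 1) fun x hx =>
      hf x (Set.Ioc_subset_Icc_self (Set.uIoc_of_le (zero_le_one' ℝ) ▸ hx))
  refine of_norm_le fun x₁ h₁ => of_norm_le fun x₂ h₂ => ?_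
  have unimodular : ‖Complex.exp (-(2 * Real.pi * Complex.I * (n.1 * x₁ + n.2 * x₂)))‖ = 1 := by
    simp [Complex.norm_exp]
  rw [norm_mul, unimodular, one_mul, Complex.norm_real]
  exact hC (x₁, x₂) ⟨h₁, h₂⟩

/-- The weight `1 + |n| + |m|` on the dual lattice, in which the Fourier coefficients of smooth
functions decay faster than any power. -/
def weight (n : ℤ × ℤ) : ℝ := 1 + |(n.1 : ℝ)| + |(n.2 : ℝ)|

theorem one_le_weight (n : ℤ × ℤ) : 1 ≤ weight n := by
  unfold weight
  linarith [abs_nonneg (n.1 : ℝ), abs_nonneg (n.2 : ℝ)]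

theorem weight_pos (n : ℤ × ℤ) : 0 < weight n := zero_lt_one.trans_le (one_le_weight n)

theorem weight_mul_norm_fourierCoef_le (hF : M.SmoothPeriodic F) (n : ℤ × ℤ) :
    weight n * ‖M.fourierCoef F n‖ ≤ ‖M.fourierCoef F n‖
      + ‖M.fourierCoef (fun r => fderiv ℝ F r M.a) n‖
      + ‖M.fourierCoef (fun r => fderiv ℝ F r M.b) n‖ := by
  have frequency (k : ℤ) : ‖(2 * Real.pi * Complex.I * k : ℂ)‖ = 2 * Real.pi * |(k : ℝ)| := by
    simp [abs_of_pos Real.pi_pos]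
  have one_le : (1 : ℝ) ≤ 2 * Real.pi := by linarith [Real.pi_gt_three]
  rw [hF.fourierCoef_fderiv_a, hF.fourierCoef_fderiv_b, norm_mul (_ * (n.1 : ℂ)),
    norm_mul (_ * (n.2 : ℂ)), frequency, frequency, weight, add_mul, add_mul, one_mul]
  gcongr <;> exact le_mul_of_one_le_left (abs_nonneg _) one_le

theorem exists_weight_pow_mul_norm_fourierCoef_le (k : ℕ) (hF : M.SmoothPeriodic F) :
    ∃ C : ℝ, ∀ n, weight n ^ k * ‖M.fourierCoef F n‖ ≤ C := by
  induction k generalizing F with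
  | zero => simpa using exists_norm_fourierCoef_le hF.1.continuous
  | succ k ih =>
    obtain ⟨C, hC⟩ := ih hF
    obtain ⟨Ca, ha⟩ := ih (hF.fderiv_apply M.a)
    obtain ⟨Cb, hb⟩ := ih (hF.fderiv_apply M.b)
    refine ⟨C + Ca + Cb, fun n => ?_⟩
    have decay := mul_le_mul_of_nonneg_left (weight_mul_norm_fourierCoef_le hF n)
      (pow_nonneg (weight_pos n).le k)
    rw [pow_succ, mul_assoc]
    linarith [hC n, ha n, hb n]

theorem summable_inv_one_add_abs_sq : Summable fun k : ℤ => ((1 + |(k : ℝ)|) ^ 2)⁻¹ := by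
  have nat : Summable fun k : ℕ => ((1 + (k : ℝ)) ^ 2)⁻¹ := by
    simpa [add_comm] using (summable_nat_add_iff 1).2 (Real.summable_nat_pow_inv.2 one_lt_two)
  exact .of_nat_of_neg (by simpa using nat) (by simpa using nat)

theorem summable_inv_weight : Summable fun n : ℤ × ℤ => (weight n ^ 4)⁻¹ := by
  refine (summable_inv_one_add_abs_sq.mul_of_nonneg summable_inv_one_add_abs_sq
    (fun k => by positivity) fun k => by positivity).of_nonneg_of_le
    (fun n => inv_nonneg.2 (pow_nonneg (weight_pos n).le 4)) fun n => ?_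
  have le_fst : 1 + |(n.1 : ℝ)| ≤ weight n := le_add_of_nonneg_right (abs_nonneg _)
  have le_snd : 1 + |(n.2 : ℝ)| ≤ weight n := by
    unfold weight
    linarith [abs_nonneg (n.1 : ℝ)]
  rw [← mul_inv, show weight n ^ 4 = weight n ^ 2 * weight n ^ 2 by ring]
  gcongr

theorem SmoothPeriodic.summable_weight_pow (hF : M.SmoothPeriodic F) (k : ℕ) :
    Summable fun n => weight n ^ k * ‖M.fourierCoef F n‖ := by
  obtain ⟨C, hC⟩ := exists_weight_pow_mul_norm_fourierCoef_le (k + 4) hF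
  refine (summable_inv_weight.mul_left C).of_nonneg_of_le
    (fun n => mul_nonneg (pow_nonneg (weight_pos n).le k) (norm_nonneg _)) fun n => ?_
  rw [← div_eq_mul_inv, le_div_iff₀ (pow_pos (weight_pos n) 4)]
  exact (by ring : _ = weight n ^ (k + 4) * ‖M.fourierCoef F n‖).trans_le (hC n)

namespace AssumptionAs

theorem contDiff_AΓ (hs : M.AssumptionAs) : ContDiff ℝ ∞ M.AΓ :=
  contDiff_euclidean.2 fun j => (hs.2 j).1

theorem smoothPeriodic_potV (hs : M.AssumptionAs) : M.SmoothPeriodic M.potV := by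
  refine ⟨?_, fun r => ?_⟩
  · unfold potV
    exact (hs.1.1.add (contDiff_const.mul (hs.contDiff_AΓ.norm_sq ℝ))).div_const _
  · simp only [potV, (M.V_per r).1, (M.V_per r).2, (M.A_per r).1, (M.A_per r).2, and_self]

theorem smoothPeriodic_const_mul_inner (hs : M.AssumptionAs) (κ : ℝ) (u : Plane) :
    M.SmoothPeriodic fun r => κ * inner ℝ u (M.AΓ r) :=
  ⟨contDiff_const.mul (contDiff_const.inner ℝ hs.contDiff_AΓ), fun r => by
    simp only [(M.A_per r).1, (M.A_per r).2, and_self]⟩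

theorem smoothPeriodic_potF₁ (hs : M.AssumptionAs) : M.SmoothPeriodic M.potF₁ :=
  hs.smoothPeriodic_const_mul_inner _ M.aStar

theorem smoothPeriodic_potF₂ (hs : M.AssumptionAs) : M.SmoothPeriodic M.potF₂ :=
  hs.smoothPeriodic_const_mul_inner _ M.bStar

theorem fderiv_const_mul_inner (hs : M.AssumptionAs) (κ : ℝ) (u v r : Plane) :
    fderiv ℝ (fun r => κ * inner ℝ u (M.AΓ r)) r v = κ * inner ℝ u (fderiv ℝ M.AΓ r v) := by
  have hA := (hs.contDiff_AΓ.differentiable (by simp) r).hasFDerivAt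
  have hinner := (((innerSL ℝ u).hasFDerivAt.comp r hA).const_mul κ).fderiv
  exact congrArg (· v) hinner

end AssumptionAs

theorem inner_aStar_add_inner_bStar (L : Plane →ₗ[ℝ] Plane) :
    inner ℝ M.aStar (L M.a) + inner ℝ M.bStar (L M.b)
      = ∑ j, L (EuclideanSpace.single j 1) j := by
  have area_ne : M.area ≠ 0 := M.area_pos.ne'
  have expand (v : Plane) :
      v = v 0 • EuclideanSpace.single 0 1 + v 1 • EuclideanSpace.single 1 1 := by
    ext i
    fin_cases i <;> simp
  rw [expand M.a, expand M.b]
  simp only [map_add, map_smul, PiLp.inner_apply, Fin.sum_univ_two, RCLike.inner_apply,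
    conj_trivial, aStar, bStar, PiLp.add_apply, PiLp.smul_apply, smul_eq_mul,
    Matrix.cons_val_zero, Matrix.cons_val_one]
  field_simp
  rw [area]
  ring

theorem fderiv_potF₁_add_fderiv_potF₂ (hs : M.AssumptionAs) (hdiv : M.DivFree) (r : Plane) :
    fderiv ℝ M.potF₁ r M.a + fderiv ℝ M.potF₂ r M.b = 0 := by
  have component (j : Fin 2) (v : Plane) :
      fderiv ℝ (fun r => M.AΓ r j) r v = fderiv ℝ M.AΓ r v j := by
    have hA := (hs.contDiff_AΓ.differentiable (by simp) r).hasFDerivAt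
    have hproj := ((EuclideanSpace.proj (𝕜 := ℝ) j).hasFDerivAt.comp r hA).fderiv
    exact congrArg (· v) hproj
  have divergence := hdiv r
  simp only [component] at divergence
  have trace :=
    (inner_aStar_add_inner_bStar (M := M) (fderiv ℝ M.AΓ r).toLinearMap).trans divergence
  have h₁ := hs.fderiv_const_mul_inner
    (2 * Real.pi * (M.chargeNumber * M.area / M.fluxQuantum)) M.aStar M.a r
  have h₂ := hs.fderiv_const_mul_inner
    (2 * Real.pi * (M.chargeNumber * M.area / M.fluxQuantum)) M.bStar M.b r
  exact (congrArg₂ (· + ·) h₁ h₂).trans (by rw [← mul_add]; exact mul_eq_zero_of_right _ trace)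

theorem fourierCoef_div_free (hs : M.AssumptionAs) (hdiv : M.DivFree) (n : ℤ × ℤ) :
    n.1 * M.fourierCoef M.potF₁ n + n.2 * M.fourierCoef M.potF₂ n = 0 := by
  have opposite : (fun r => fderiv ℝ M.potF₂ r M.b) = fun r => -fderiv ℝ M.potF₁ r M.a :=
    funext fun r => eq_neg_of_add_eq_zero_right (fderiv_potF₁_add_fderiv_potF₂ hs hdiv r)
  have coef_neg : M.fourierCoef (fun r => -fderiv ℝ M.potF₁ r M.a) n
      = -M.fourierCoef (fun r => fderiv ℝ M.potF₁ r M.a) n := by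
    simp [fourierCoef, intervalIntegral.integral_neg]
  have coef := hs.smoothPeriodic_potF₂.fourierCoef_fderiv_b n
  rw [opposite, coef_neg, hs.smoothPeriodic_potF₁.fourierCoef_fderiv_a] at coef
  refine mul_left_cancel₀ Complex.two_pi_I_ne_zero ?_
  linear_combination -coef

end BlochLandau

/-! ### Graphs of unbounded operators -/

section Graph

variable {R X Y Z : Type*} [Ring R] [AddCommGroup X] [Module R X] [AddCommGroup Y] [Module R Y]
  [AddCommGroup Z] [Module R Z] {S T : X →ₗ.[R] Y} {ψ : X} {v w : Y}

theorem mem_graph_iff_exists : (ψ, v) ∈ T.graph ↔ ∃ h : ψ ∈ T.domain, T ⟨ψ, h⟩ = v := by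
  simp only [LinearPMap.mem_graph_iff, Subtype.exists]
  exact ⟨fun ⟨_, h, rfl, e⟩ => ⟨h, e⟩, fun ⟨h, e⟩ => ⟨ψ, h, rfl, e⟩⟩

theorem add_mem_graph (hS : (ψ, v) ∈ S.graph) (hT : (ψ, w) ∈ T.graph) :
    (ψ, v + w) ∈ (S + T).graph := by
  rw [mem_graph_iff_exists] at *
  obtain ⟨h, rfl⟩ := hS
  obtain ⟨h', rfl⟩ := hT
  exact ⟨⟨h, h'⟩, rfl⟩

theorem sub_mem_graph (hS : (ψ, v) ∈ S.graph) (hT : (ψ, w) ∈ T.graph) :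
    (ψ, v - w) ∈ (S - T).graph := by
  rw [mem_graph_iff_exists] at *
  obtain ⟨h, rfl⟩ := hS
  obtain ⟨h', rfl⟩ := hT
  exact ⟨⟨h, h'⟩, rfl⟩

theorem compPMap_mem_graph (L : Y →ₗ[R] Z) (hT : (ψ, v) ∈ T.graph) :
    (ψ, L v) ∈ (L.compPMap T).graph := by
  rw [mem_graph_iff_exists] at *
  obtain ⟨h, rfl⟩ := hT
  exact ⟨h, rfl⟩

theorem toPMap_mem_graph (L : X →ₗ[R] Y) : (ψ, L ψ) ∈ (L.toPMap ⊤).graph :=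
  mem_graph_iff_exists.2 ⟨trivial, rfl⟩

theorem smul_mem_graph {c : R} [SMulCommClass R R Y] (hT : (ψ, v) ∈ T.graph) :
    (ψ, c • v) ∈ (c • T).graph := by
  rw [mem_graph_iff_exists] at *
  obtain ⟨h, rfl⟩ := hT
  exact ⟨h, rfl⟩

theorem smul_add_linearPMap [SMulCommClass R R Y] (c : R) (S T : X →ₗ.[R] Y) :
    c • (S + T) = c • S + c • T :=
  LinearPMap.ext rfl fun _ _ _ => smul_add _ _ _

theorem smul_zero_linearPMap [SMulCommClass R R Y] (c : R) : c • (0 : X →ₗ.[R] Y) = 0 :=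
  LinearPMap.ext rfl fun _ _ _ => smul_zero _

end Graph

theorem opSeries_mem_graph {κ : Type} {T : κ → Hf →ₗ.[ℂ] Hf} {ψ : Hf} {v : κ → Hf}
    (h : ∀ i, (ψ, v i) ∈ (T i).graph) (hv : Summable v) :
    (ψ, ∑' i, v i) ∈ (opSeries T).graph := by
  simp only [mem_graph_iff_exists] at *
  choose h e using h
  obtain rfl : (fun i => T i ⟨ψ, h i⟩) = v := funext e
  exact ⟨⟨h, hv⟩, rfl⟩

theorem exists_tendsto_of_norm_le_mul {D X Y F G : Type*} [AddCommGroup D]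
    [SeminormedAddCommGroup X] [SeminormedAddCommGroup Y] [CompleteSpace Y]
    [FunLike F D X] [AddMonoidHomClass F D X] [FunLike G D Y] [AddMonoidHomClass G D Y]
    {f : F} {g : G} {l : Filter D} [l.NeBot] {η : X} {K : ℝ}
    (hg : ∀ φ, ‖g φ‖ ≤ K * ‖f φ‖) (hf : l.Tendsto f (nhds η)) :
    ∃ v, l.Tendsto g (nhds v) := by
  refine cauchy_map_iff_exists_tendsto.1 (cauchy_map_iff'.2 ?_)
  rw [Metric.uniformity_eq_comap_nhds_zero, Filter.tendsto_comap_iff]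
  have dist_f : (l ×ˢ l).Tendsto (fun φ => K * dist (f φ.1) (f φ.2)) (nhds 0) := by
    simpa using ((hf.comp Filter.tendsto_fst).dist (hf.comp Filter.tendsto_snd)).const_mul K
  refine squeeze_zero (fun _ => dist_nonneg) (fun φ => ?_) dist_f
  simpa only [Function.comp_apply, dist_eq_norm, map_sub] using hg (φ.1 - φ.2)

namespace BlochLandau

variable {M : BlochLandau}

theorem mem_onHermite_graph {T : Sch →L[ℂ] Sch} {y : Hf × Hf} :
    y ∈ (M.onHermite T).graph ↔ ∃ φ ∈ M.hermiteSpan, (schIncl φ, schIncl (T φ)) = y := by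
  have graph_eq : (M.onHermite T).graph = M.hermiteSpan.map
      (schIncl.toLinearMap.prod (schIncl ∘L T).toLinearMap) := by
    refine Submodule.toLinearPMap_graph_eq _ ?_
    rintro _ ⟨φ, -, rfl⟩ h
    obtain rfl : φ = 0 := injective_schIncl (h.trans schIncl.map_zero.symm)
    exact map_zero _
  rw [graph_eq]
  rfl

theorem closedOp_graph {T : Sch →L[ℂ] Sch} {u : Sch →L[ℂ] Hf}
    (h : IsFormalAdjoint schIncl (schIncl ∘L T) u) :
    (M.closedOp T).graph = (M.onHermite T).graph.topologicalClosure := by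
  have weak : ∀ y ∈ (M.onHermite T).graph.topologicalClosure, ∀ χ : Sch,
      inner ℂ y.2 (schIncl χ) = inner ℂ y.1 (u χ) := fun y hy χ => by
    refine closure_minimal (t := {y : Hf × Hf | inner ℂ y.2 (schIncl χ) = inner ℂ y.1 (u χ)})
      (fun z hz => ?_) (isClosed_eq (by fun_prop) (by fun_prop)) hy
    obtain ⟨φ, -, rfl⟩ := mem_onHermite_graph.1 hz
    exact h φ χ
  have closable : (M.onHermite T).IsClosable := by
    refine ⟨(M.onHermite T).graph.topologicalClosure.toLinearPMap, ?_⟩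
    rw [Submodule.toLinearPMap_graph_eq]
    intro y hy hy₁
    refine norm_le_zero_iff.1 <|
      norm_le_of_forall_norm_inner_le denseRange_schIncl le_rfl fun χ => ?_
    rw [weak y hy, hy₁, inner_zero_left, norm_zero, zero_mul]
  rw [closedOp, closable.graph_closure_eq_closure_graph]

variable (M) in
/-- The filter of those Schwartz functions in `𝓛` that approach the point `y` in the graph norm
of `Ξ`. An operator on `𝓛` that is bounded relatively to `Ξ` is extended to `𝓕` by taking limits
along these filters. -/
def coreNhds (y : Hf × Hf) : Filter Sch :=
  .principal M.hermiteSpan ⊓ (nhds y).comap fun φ => (schIncl φ, schIncl (M.xiSch φ))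

theorem eventually_mem_hermiteSpan (y : Hf × Hf) : ∀ᶠ φ in M.coreNhds y, φ ∈ M.hermiteSpan :=
  Filter.mem_inf_of_left (Filter.mem_principal_self _)

theorem pure_le_coreNhds {χ : Sch} (hχ : χ ∈ M.hermiteSpan) :
    pure χ ≤ M.coreNhds (schIncl χ, schIncl (M.xiSch χ)) :=
  le_inf ((Filter.pure_le_principal _).2 hχ)
    (Filter.map_le_iff_le_comap.1 ((Filter.map_pure _ _).trans_le (pure_le_nhds _)))

theorem tendsto_coreNhds (y : Hf × Hf) : (M.coreNhds y).Tendsto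
    (fun φ => (schIncl φ, schIncl (M.xiSch φ))) (nhds y) :=
  Filter.tendsto_comap.mono_left inf_le_right

theorem mem_xi_graph {χ : Sch} (hχ : χ ∈ M.hermiteSpan) :
    (schIncl χ, schIncl (M.xiSch χ)) ∈ M.xi.graph := by
  rw [xi, closedOp_graph M.isFormalAdjoint_xiSch]
  exact subset_closure (mem_onHermite_graph.2 ⟨χ, hχ, rfl⟩)

theorem neBot_coreNhds {y : Hf × Hf} (hy : y ∈ M.xi.graph) : (M.coreNhds y).NeBot := by
  rw [xi, closedOp_graph M.isFormalAdjoint_xiSch] at hy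
  refine .of_map (m := fun φ => (schIncl φ, schIncl (M.xiSch φ))) ?_
  rw [coreNhds, Filter.push_pull, Filter.map_principal, inf_comm]
  refine (mem_closure_iff_clusterPt.1 hy).mono (Filter.principal_mono.2 ?_)
  intro z hz
  obtain ⟨φ, hφ, rfl⟩ := mem_onHermite_graph.1 hz
  exact ⟨φ, hφ, rfl⟩

theorem mem_closedOp_graph_of_tendsto {T : Sch →L[ℂ] Sch} {u : Sch →L[ℂ] Hf}
    (h : IsFormalAdjoint schIncl (schIncl ∘L T) u) {y : Hf × Hf} (hy : y ∈ M.xi.graph) {v : Hf}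
    (hv : (M.coreNhds y).Tendsto (schIncl ∘L T) (nhds v)) : (y.1, v) ∈ (M.closedOp T).graph := by
  have := neBot_coreNhds hy
  rw [closedOp_graph h]
  exact mem_closure_of_tendsto ((tendsto_coreNhds y).fst_nhds.prodMk_nhds hv)
    ((eventually_mem_hermiteSpan y).mono fun φ hφ => mem_onHermite_graph.2 ⟨φ, hφ, rfl⟩)

theorem exists_tendsto_coreNhds {u : Sch →L[ℂ] Hf} {K : ℝ}
    (hu : ∀ φ, ‖u φ‖ ≤ K * ‖schIncl (M.xiSch φ)‖) {y : Hf × Hf} (hy : y ∈ M.xi.graph) :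
    ∃ v, (M.coreNhds y).Tendsto u (nhds v) :=
  have := neBot_coreNhds hy
  exists_tendsto_of_norm_le_mul (f := schIncl ∘L M.xiSch) hu (tendsto_coreNhds y).snd_nhds

/-! ### Relatively bounded operators and series of such on `𝓕` -/

variable (M) in
/-- The unbounded operator `T` is defined on all of `𝓕`, where it is the extension by continuity
of the operator `u` on `𝓛`. -/
def ExtendsOnCore (T : Hf →ₗ.[ℂ] Hf) (u : Sch →L[ℂ] Hf) : Prop :=
  ∀ y ∈ M.xi.graph, ∃ v, (M.coreNhds y).Tendsto u (nhds v) ∧ (y.1, v) ∈ T.graph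

namespace ExtendsOnCore

variable {S T : Hf →ₗ.[ℂ] Hf} {u w : Sch →L[ℂ] Hf}

theorem closedOp {T : Sch →L[ℂ] Sch} (hT : IsFormalAdjoint schIncl (schIncl ∘L T) u) {K : ℝ}
    (hK : ∀ φ, ‖schIncl (T φ)‖ ≤ K * ‖schIncl (M.xiSch φ)‖) :
    M.ExtendsOnCore (M.closedOp T) (schIncl ∘L T) := fun _ hy =>
  have ⟨v, hv⟩ := exists_tendsto_coreNhds (u := schIncl ∘L T) hK hy
  ⟨v, hv, mem_closedOp_graph_of_tendsto hT hy hv⟩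

theorem add (hS : M.ExtendsOnCore S u) (hT : M.ExtendsOnCore T w) :
    M.ExtendsOnCore (S + T) (u + w) := fun y hy =>
  have ⟨_, hv, gv⟩ := hS y hy
  have ⟨_, hw, gw⟩ := hT y hy
  ⟨_, hv.add hw, add_mem_graph gv gw⟩

theorem smul (hT : M.ExtendsOnCore T u) (c : ℂ) : M.ExtendsOnCore (c • T) (c • u) := fun y hy =>
  have ⟨_, hv, gv⟩ := hT y hy
  ⟨_, hv.const_smul c, smul_mem_graph gv⟩

theorem compPMap (hT : M.ExtendsOnCore T u) (L : Hf →L[ℂ] Hf) :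
    M.ExtendsOnCore (L.toLinearMap.compPMap T) (L ∘L u) := fun y hy =>
  have ⟨_, hv, gv⟩ := hT y hy
  ⟨_, (L.continuous.tendsto _).comp hv, compPMap_mem_graph L.toLinearMap gv⟩

theorem toPMap (L : Hf →L[ℂ] Hf) :
    M.ExtendsOnCore (L.toLinearMap.toPMap ⊤) (L ∘L schIncl) := fun y _ =>
  ⟨_, (L.continuous.tendsto _).comp (tendsto_coreNhds y).fst_nhds,
    toPMap_mem_graph L.toLinearMap⟩

end ExtendsOnCore

variable {κ : Type}

variable (M) in
/-- The operators `u n` are bounded relatively to `Ξ`, with summable bounds. -/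
def XiSummable (u : κ → Sch →L[ℂ] Hf) : Prop :=
  ∃ B : κ → ℝ, Summable B ∧ ∀ n φ, ‖u n φ‖ ≤ B n * ‖schIncl (M.xiSch φ)‖

theorem XiSummable.of_norm_le {u w : κ → Sch →L[ℂ] Hf} (hu : M.XiSummable u) {C : ℝ}
    (hC : 0 ≤ C) (h : ∀ n φ, ‖w n φ‖ ≤ C * ‖u n φ‖) : M.XiSummable w := by
  obtain ⟨B, hB, hle⟩ := hu
  refine ⟨fun n => C * B n, hB.mul_left C, fun n φ => (h n φ).trans ?_⟩
  rw [mul_assoc]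
  exact mul_le_mul_of_nonneg_left (hle n φ) hC

variable (M) in
/-- The unbounded operator `T` is defined on all of `𝓕`, where it is the sum of the series of the
extensions by continuity of the operators `u n` on `𝓛`. -/
def HasModes (T : Hf →ₗ.[ℂ] Hf) (u : κ → Sch →L[ℂ] Hf) : Prop :=
  ∀ y ∈ M.xi.graph, ∃ v : κ → Hf, (∀ n, (M.coreNhds y).Tendsto (u n) (nhds (v n))) ∧
    Summable v ∧ (y.1, ∑' n, v n) ∈ T.graph

namespace HasModes

variable {S T : Hf →ₗ.[ℂ] Hf} {u w : κ → Sch →L[ℂ] Hf}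

theorem opSeries {T : κ → Hf →ₗ.[ℂ] Hf} (hu : M.XiSummable u)
    (hT : ∀ n, M.ExtendsOnCore (T n) (u n)) : M.HasModes (opSeries T) u := fun y hy => by
  have := neBot_coreNhds hy
  choose v hv gv using fun n => hT n y hy
  obtain ⟨B, hB, hle⟩ := hu
  have summable_v : Summable v := (hB.mul_right ‖y.2‖).of_norm_bounded fun n =>
    le_of_tendsto_of_tendsto' (hv n).norm ((tendsto_coreNhds y).snd_nhds.norm.const_mul _) (hle n)
  exact ⟨v, hv, summable_v, opSeries_mem_graph gv summable_v⟩

theorem zero : M.HasModes 0 (0 : κ → Sch →L[ℂ] Hf) := fun _ _ =>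
  ⟨0, fun _ => tendsto_const_nhds, summable_zero, by simp⟩

theorem add (hS : M.HasModes S u) (hT : M.HasModes T w) : M.HasModes (S + T) (u + w) :=
  fun y hy =>
    have ⟨v, hv, sv, gv⟩ := hS y hy
    have ⟨v', hv', sv', gv'⟩ := hT y hy
    ⟨v + v', fun n => (hv n).add (hv' n), sv.add sv', sv.tsum_add sv' ▸ add_mem_graph gv gv'⟩

theorem smul (hT : M.HasModes T u) (c : ℂ) : M.HasModes (c • T) (c • u) := fun y hy =>
  have ⟨v, hv, sv, gv⟩ := hT y hy
  ⟨c • v, fun n => (hv n).const_smul c, sv.const_smul c,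
    (sv.tsum_const_smul c).symm ▸ smul_mem_graph gv⟩

theorem sum {s : Finset ℕ} {T : ℕ → Hf →ₗ.[ℂ] Hf} {u : ℕ → κ → Sch →L[ℂ] Hf}
    (h : ∀ j ∈ s, M.HasModes (T j) (u j)) : M.HasModes (∑ j ∈ s, T j) (∑ j ∈ s, u j) := by
  induction s using Finset.induction_on with
  | empty => exact zero
  | insert j s hj ih =>
    rw [Finset.sum_insert hj, Finset.sum_insert hj]
    exact (h j (s.mem_insert_self j)).add (ih fun i hi => h i (Finset.mem_insert_of_mem hi))

theorem xi_add_sub_xi_add (hS : M.HasModes S u) (hT : M.HasModes T w) :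
    M.HasModes ((M.xi + S) - (M.xi + T)) (u - w) := fun y hy => by
  obtain ⟨v, hv, sv, gv⟩ := hS y hy
  obtain ⟨v', hv', sv', gv'⟩ := hT y hy
  refine ⟨v - v', fun n => (hv n).sub (hv' n), sv.sub sv', ?_⟩
  have difference := sub_mem_graph (add_mem_graph hy gv) (add_mem_graph hy gv')
  rwa [add_sub_add_left_eq_sub, ← sv.tsum_sub sv'] at difference

theorem hasSum (hT : M.HasModes T u) {χ : Sch} (hχ : χ ∈ M.hermiteSpan) :
    ∃ v, HasSum (fun n => u n χ) v ∧ (schIncl χ, v) ∈ T.graph := by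
  obtain ⟨v, hv, sv, gv⟩ := hT _ (mem_xi_graph hχ)
  have v_eq (n) : v n = u n χ :=
    tendsto_nhds_unique ((hv n).mono_left (pure_le_coreNhds hχ)) (tendsto_pure_nhds _ _)
  exact ⟨_, funext v_eq ▸ sv.hasSum, gv⟩

theorem normFLe (hT : M.HasModes T u) {B : κ → ℝ} (hB : Summable B)
    (hu : ∀ n φ, ‖u n φ‖ ≤ B n * ‖schIncl (M.xiSch φ)‖) : M.NormFLe T (∑' n, B n) := fun ψ => by
  have hψ := M.xi.mem_graph ψ
  have := neBot_coreNhds hψ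
  obtain ⟨v, hv, -, gv⟩ := hT _ hψ
  obtain ⟨dom, value⟩ := mem_graph_iff_exists.1 gv
  refine ⟨dom, value ▸ ?_⟩
  refine tsum_of_norm_bounded (hB.hasSum.mul_right _) fun n => ?_
  exact le_of_tendsto_of_tendsto' (hv n).norm
    ((tendsto_coreNhds _).snd_nhds.norm.const_mul _) (hu n)

theorem inner_eq (hT : M.HasModes T u) (σ : κ ≃ κ)
    (hσ : ∀ n, IsFormalAdjoint schIncl (u n) (u (σ n))) {χ : Sch} (hχ : χ ∈ M.hermiteSpan)
    {v : Hf} (hv : (schIncl χ, v) ∈ T.graph) {y : Hf × Hf} (hy : y ∈ M.xi.graph) {w : Hf}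
    (hw : (y.1, w) ∈ T.graph) : inner ℂ v y.1 = inner ℂ (schIncl χ) w := by
  have := neBot_coreNhds hy
  obtain ⟨v', sum_v, gv⟩ := hT.hasSum hχ
  obtain rfl : v = v' := T.mem_graph_snd_inj hv gv rfl
  obtain ⟨w', hw', sw, gw⟩ := hT y hy
  obtain rfl : w = _ := T.mem_graph_snd_inj hw gw rfl
  have mode (n) : inner ℂ (u n χ) y.1 = inner ℂ (schIncl χ) (w' (σ n)) :=
    tendsto_nhds_unique
      ((tendsto_const_nhds.inner (tendsto_coreNhds y).fst_nhds).congr (hσ n χ))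
      (tendsto_const_nhds.inner (hw' (σ n)))
  have left : HasSum (fun n => inner ℂ (u n χ) y.1) (inner ℂ v y.1) := by
    simpa using (((innerSL ℂ y.1).hasSum sum_v).star)
  have right := (innerSL ℂ (schIncl χ)).hasSum (σ.hasSum_iff.2 sw.hasSum)
  exact left.unique (funext mode ▸ right)

end HasModes

end BlochLandau

namespace BlochLandau

variable (M : BlochLandau)

/-! ### Bounds for the Fourier modes of the symbols -/

/-- The coefficient `f¹_{n,m} Q + f²_{n,m} P` of the Fourier mode `(n, m)` of `W_δ`. -/
def fSch (n : ℤ × ℤ) : Sch →L[ℂ] Sch :=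
  M.linSch (M.fourierCoef M.potF₁ n) (M.fourierCoef M.potF₂ n)

theorem fSch_eq_zero (hA : M.AΓ = 0) (n : ℤ × ℤ) : M.fSch n = 0 := by
  simp [fSch, linSch, fourierCoef, potF₁, potF₂, hA]

theorem nat_cases : M.nat = 0 ∨ M.nat = 1 ∧ M.AΓ = 0 := by
  unfold nat
  split_ifs with hA
  exacts [.inr ⟨rfl, hA⟩, .inl rfl]

theorem norm_add_norm_le_weight (n : ℤ × ℤ) : ‖(-(n.2 : ℂ))‖ + ‖(n.1 : ℂ)‖ ≤ weight n := by
  rw [norm_neg, Complex.norm_intCast, Complex.norm_intCast, weight]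
  linarith

theorem norm_iSch_pow_le_xi (n : ℤ × ℤ) {j : ℕ} (hj : j ≤ 2) (φ : Sch) :
    ‖schIncl ((M.iSch n ^ j) φ)‖
      ≤ 3 * (M.ladderBound * weight n) ^ j * ‖schIncl (M.xiSch φ)‖ := by
  have bound_nonneg := M.ladderBound_nonneg
  have weight_pos := weight_pos n
  have coef_le := norm_add_norm_le_weight n
  interval_cases j
  · simpa using M.norm_schIncl_le_xi φ
  · rw [pow_one, pow_one, iSch_eq_linSch]
    exact (M.norm_linSch_le_xi _ _ φ).trans (by gcongr)
  · rw [sq, sq, iSch_eq_linSch]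
    exact (M.norm_linSch_linSch_le_xi _ _ _ _ φ).trans (by gcongr)

theorem norm_iSch_pow_linSch_le_xi (n : ℤ × ℤ) (u v : ℂ) {j : ℕ} (hj : j ≤ 1) (φ : Sch) :
    ‖schIncl ((M.iSch n ^ j) (M.linSch u v φ))‖
      ≤ 3 * ((M.ladderBound * weight n) ^ j * (M.ladderBound * (‖u‖ + ‖v‖)))
        * ‖schIncl (M.xiSch φ)‖ := by
  have bound_nonneg := M.ladderBound_nonneg
  have coef_le := norm_add_norm_le_weight n
  interval_cases j
  · simpa using M.norm_linSch_le_xi u v φ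
  · rw [pow_one, pow_one, iSch_eq_linSch]
    exact (M.norm_linSch_linSch_le_xi _ _ u v φ).trans (by gcongr)

theorem exists_norm_iSch_pow_apply_le (j : ℕ) (φ : Sch) :
    ∃ C : ℝ, ∀ n, ‖schIncl ((M.iSch n ^ j) φ)‖ ≤ C * weight n ^ j := by
  induction j generalizing φ with
  | zero => exact ⟨‖schIncl φ‖, fun n => by simp⟩
  | succ j ih =>
    obtain ⟨C, hC⟩ := ih (M.P φ)
    obtain ⟨D, hD⟩ := ih (Q φ)
    refine ⟨C + D, fun n => ?_⟩
    have fst_le : ‖(n.1 : ℂ)‖ ≤ weight n :=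
      (le_add_of_nonneg_left (norm_nonneg _)).trans (norm_add_norm_le_weight n)
    have snd_le : ‖(n.2 : ℂ)‖ ≤ weight n := by
      simpa using (le_add_of_nonneg_right (norm_nonneg _)).trans (norm_add_norm_le_weight n)
    calc ‖schIncl ((M.iSch n ^ (j + 1)) φ)‖
        = ‖(n.1 : ℂ) • schIncl ((M.iSch n ^ j) (M.P φ))
            - (n.2 : ℂ) • schIncl ((M.iSch n ^ j) (Q φ))‖ := by
          rw [pow_succ, mul_apply_eq_comp, iSch, sub_apply, smul_apply, smul_apply, map_sub,
            map_smul, map_smul, map_sub, map_smul, map_smul]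
      _ ≤ ‖(n.1 : ℂ)‖ * ‖schIncl ((M.iSch n ^ j) (M.P φ))‖
            + ‖(n.2 : ℂ)‖ * ‖schIncl ((M.iSch n ^ j) (Q φ))‖ :=
          (norm_sub_le _ _).trans_eq (by rw [norm_smul, norm_smul])
      _ ≤ weight n * (C * weight n ^ j) + weight n * (D * weight n ^ j) :=
          add_le_add (mul_le_mul fst_le (hC n) (norm_nonneg _) (weight_pos n).le)
            (mul_le_mul snd_le (hD n) (norm_nonneg _) (weight_pos n).le)
      _ = (C + D) * weight n ^ (j + 1) := by ring

variable {M}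

theorem SmoothPeriodic.summable_norm_iSch_pow {F : Plane → ℝ} (hF : M.SmoothPeriodic F) (j : ℕ)
    (φ : Sch) : Summable fun n => ‖M.fourierCoef F n‖ * ‖schIncl ((M.iSch n ^ j) φ)‖ := by
  obtain ⟨C, hC⟩ := M.exists_norm_iSch_pow_apply_le j φ
  refine ((hF.summable_weight_pow j).mul_left C).of_nonneg_of_le (fun n => by positivity)
    fun n => (mul_le_mul_of_nonneg_left (hC n) (norm_nonneg _)).trans_eq ?_
  ring

theorem summable_norm_iSch_pow_fSch (hs : M.AssumptionAs) (j : ℕ) (φ : Sch) :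
    Summable fun n => ‖schIncl ((M.iSch n ^ j) (M.fSch n φ))‖ := by
  refine ((hs.smoothPeriodic_potF₁.summable_norm_iSch_pow j (Q φ)).add
    (hs.smoothPeriodic_potF₂.summable_norm_iSch_pow j (M.P φ))).of_nonneg_of_le
    (fun n => norm_nonneg _) fun n => ?_
  simp only [fSch, linSch, add_apply, smul_apply, map_add, map_smul]
  exact (norm_add_le _ _).trans_eq (by rw [norm_smul, norm_smul])

theorem xiSummable_coef_smul_iSch_pow (hs : M.AssumptionAs) {j : ℕ} (hj : j ≤ 2) :
    M.XiSummable fun n => M.fourierCoef M.potV n • (schIncl ∘L M.iSch n ^ j) := by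
  refine ⟨_, (hs.smoothPeriodic_potV.summable_weight_pow j).mul_left (3 * M.ladderBound ^ j),
    fun n φ => ?_⟩
  rw [smul_apply, norm_smul]
  refine (mul_le_mul_of_nonneg_left (M.norm_iSch_pow_le_xi n hj φ) (norm_nonneg _)).trans_eq ?_
  ring

theorem xiSummable_iSch_pow_fSch (hs : M.AssumptionAs) {j : ℕ} (hj : j ≤ 2 * M.nat + 1) :
    M.XiSummable fun n => schIncl ∘L ((M.iSch n ^ j) ∘L M.fSch n) := by
  rcases M.nat_cases with nat_eq | ⟨-, hA⟩
  · refine ⟨_, ((hs.smoothPeriodic_potF₁.summable_weight_pow j).add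
      (hs.smoothPeriodic_potF₂.summable_weight_pow j)).mul_left (3 * M.ladderBound ^ (j + 1)),
      fun n φ => (M.norm_iSch_pow_linSch_le_xi n _ _ (by omega) φ).trans_eq ?_⟩
    ring
  · exact ⟨0, summable_zero, fun n φ => by simp [M.fSch_eq_zero hA]⟩

/-! ### The terms of the remainder -/

theorem norm_phase (p x : ℝ) (n : ℤ × ℤ) : ‖phase p x n‖ = 1 := by
  have exponent : (2 * Real.pi * Complex.I * (n.1 * p + n.2 * x) : ℂ)
      = ((2 * Real.pi * (n.1 * p + n.2 * x) : ℝ) : ℂ) * Complex.I := by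
    push_cast
    ring
  rw [phase, exponent, Complex.norm_exp_ofReal_mul_I]

theorem phase_neg (p x : ℝ) (n : ℤ × ℤ) : phase p x (-n) = starRingEnd ℂ (phase p x n) := by
  simp only [phase, ← Complex.exp_conj, map_mul, map_add, Complex.conj_ofReal, Complex.conj_I,
    Complex.conj_ofNat, map_intCast, Prod.fst_neg, Prod.snd_neg]
  congr 1
  push_cast
  ring

theorem norm_jSch_pow (n : ℤ × ℤ) (j : ℕ) (φ : Sch) :
    ‖schIncl ((M.jSch n ^ j) φ)‖ = (2 * Real.pi) ^ j * ‖schIncl ((M.iSch n ^ j) φ)‖ := by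
  rw [jSch, smul_pow, smul_apply, map_smul, norm_smul, norm_pow]
  simp [abs_of_pos Real.pi_pos]

variable (M) in
/-- The remainder of order `k` of the Taylor expansion of `exp (2πiδ I_{n,m})` in `δ`. -/
def expRem (n : ℤ × ℤ) (k : ℕ) (δ : ℝ) : Sch →L[ℂ] Hf :=
  taylorRem schIncl (M.jSch n) (M.expSch n) k δ

theorem norm_expRem_le (n : ℤ × ℤ) (k : ℕ) {δ : ℝ} (hδ : 0 ≤ δ) (φ : Sch) :
    ‖M.expRem n k δ φ‖ ≤ δ ^ k * ((2 * Real.pi) ^ k * ‖schIncl ((M.iSch n ^ k) φ)‖) := by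
  rw [← norm_jSch_pow]
  exact (M.isWeakFlow_expSch n).norm_taylorRem_le denseRange_schIncl k hδ φ

theorem norm_expRem_succ_le (n : ℤ × ℤ) (k : ℕ) {δ : ℝ} (hδ : 0 ≤ δ) (φ : Sch) :
    ‖M.expRem n (k + 1) δ φ‖
      ≤ δ ^ k * (2 * (2 * Real.pi) ^ k * ‖schIncl ((M.iSch n ^ k) φ)‖) := by
  rw [mul_assoc 2, ← norm_jSch_pow]
  exact (M.isWeakFlow_expSch n).norm_taylorRem_succ_le denseRange_schIncl k hδ φ

variable (M) in
/-- The contribution of the Fourier mode `n` to the remainder symbol `R_δ`. -/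
def remTerm (δ p x : ℝ) (n : ℤ × ℤ) : Sch →L[ℂ] Hf :=
  phase p x n • ((δ : ℂ) • (M.expRem n (2 * M.nat + 2) δ ∘L M.fSch n)
    + ((δ ^ 2 : ℝ) : ℂ) • M.fourierCoef M.potV n • M.expRem n (2 * M.nat + 1) δ)

theorem norm_remTerm_le {δ : ℝ} (hδ : 0 ≤ δ) (p x : ℝ) {n : ℤ × ℤ} {φ : Sch} {k : ℕ} {a b : ℝ}
    (ha : ‖M.expRem n (2 * M.nat + 2) δ (M.fSch n φ)‖ ≤ δ ^ (k + 1) * a)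
    (hb : ‖M.expRem n (2 * M.nat + 1) δ φ‖ ≤ δ ^ k * b) :
    ‖M.remTerm δ p x n φ‖ ≤ δ ^ (k + 2) * (a + ‖M.fourierCoef M.potV n‖ * b) := by
  calc ‖M.remTerm δ p x n φ‖
      ≤ δ * ‖M.expRem n (2 * M.nat + 2) δ (M.fSch n φ)‖
        + δ ^ 2 * (‖M.fourierCoef M.potV n‖ * ‖M.expRem n (2 * M.nat + 1) δ φ‖) := by
        rw [remTerm, smul_apply, norm_smul, norm_phase, one_mul, add_apply]
        refine (norm_add_le _ _).trans_eq ?_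
        simp only [smul_apply, norm_smul, Complex.norm_real, Real.norm_eq_abs, abs_of_nonneg hδ,
          abs_of_nonneg (sq_nonneg δ), ContinuousLinearMap.comp_apply]
    _ ≤ δ * (δ ^ (k + 1) * a) + δ ^ 2 * (‖M.fourierCoef M.potV n‖ * (δ ^ k * b)) := by gcongr
    _ = δ ^ (k + 2) * (a + ‖M.fourierCoef M.potV n‖ * b) := by ring

theorem exists_norm_remTerm_le_xi (hs : M.AssumptionAs) : ∃ B : ℤ × ℤ → ℝ, Summable B ∧
    ∀ δ : ℝ, 0 ≤ δ → ∀ p x n φ, ‖M.remTerm δ p x n φ‖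
      ≤ δ ^ (2 * M.nat + 2) * B n * ‖schIncl (M.xiSch φ)‖ := by
  have nat_le : 2 * M.nat ≤ 2 := by
    rcases M.nat_cases with h | ⟨h, -⟩ <;> omega
  obtain ⟨A, summable_A, hA⟩ := xiSummable_iSch_pow_fSch hs le_rfl
  obtain ⟨B, summable_B, hB⟩ := xiSummable_coef_smul_iSch_pow hs nat_le
  set c : ℕ → ℝ := fun k => 2 * (2 * Real.pi) ^ k
  refine ⟨_, (summable_A.mul_left (c (2 * M.nat + 1))).add (summable_B.mul_left (c (2 * M.nat))),
    fun δ hδ p x n φ => ?_⟩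
  have scalar := hB n φ
  rw [smul_apply, norm_smul] at scalar
  calc ‖M.remTerm δ p x n φ‖
      ≤ δ ^ (2 * M.nat + 2)
        * (c (2 * M.nat + 1) * ‖schIncl ((M.iSch n ^ (2 * M.nat + 1)) (M.fSch n φ))‖
          + ‖M.fourierCoef M.potV n‖
            * (c (2 * M.nat) * ‖schIncl ((M.iSch n ^ (2 * M.nat)) φ)‖)) :=
        norm_remTerm_le hδ p x (norm_expRem_succ_le n _ hδ _) (norm_expRem_succ_le n _ hδ _)
    _ ≤ δ ^ (2 * M.nat + 2) * (c (2 * M.nat + 1) * (A n * ‖schIncl (M.xiSch φ)‖)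
          + c (2 * M.nat) * (B n * ‖schIncl (M.xiSch φ)‖)) := by
        rw [mul_left_comm ‖M.fourierCoef _ n‖]
        gcongr _ * (_ * ?_ + _ * ?_)
        exacts [hA n φ, scalar]
    _ = δ ^ (2 * M.nat + 2) * (c (2 * M.nat + 1) * A n + c (2 * M.nat) * B n)
          * ‖schIncl (M.xiSch φ)‖ := by ring

theorem exists_norm_remTerm_le (hs : M.AssumptionAs) (φ : Sch) : ∃ B : ℤ × ℤ → ℝ, Summable B ∧
    ∀ δ : ℝ, 0 ≤ δ → ∀ p x n, ‖M.remTerm δ p x n φ‖ ≤ δ ^ (2 * M.nat + 3) * B n := by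
  refine ⟨_, ((summable_norm_iSch_pow_fSch hs (2 * M.nat + 2) φ).mul_left
      ((2 * Real.pi) ^ (2 * M.nat + 2))).add
    ((hs.smoothPeriodic_potV.summable_norm_iSch_pow (2 * M.nat + 1) φ).mul_left
      ((2 * Real.pi) ^ (2 * M.nat + 1))), fun δ hδ p x n => ?_⟩
  refine (norm_remTerm_le hδ p x (norm_expRem_le n _ hδ _) (norm_expRem_le n _ hδ _)).trans_eq ?_
  ring

/-! ### Symmetry of the remainder -/

theorem isFormalAdjoint_fSch (n : ℤ × ℤ) :
    IsFormalAdjoint schIncl (schIncl ∘L M.fSch n) (schIncl ∘L M.fSch (-n)) := by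
  simpa only [fSch, fourierCoef_conj] using
    M.isFormalAdjoint_linSch (M.fourierCoef M.potF₁ n) (M.fourierCoef M.potF₂ n)

/-- This is where the gauge condition enters: it makes `f¹_{n,m} Q + f²_{n,m} P` commute
with `I_{n,m}`. -/
theorem exists_fSch_eq_smul_jSch (hs : M.AssumptionAs) (hdiv : M.DivFree) {n : ℤ × ℤ}
    (hn : n ≠ 0) : ∃ c : ℂ, M.fSch n = c • M.jSch n := by
  have gauge := fourierCoef_div_free hs hdiv n
  have two_pi_I_ne : (2 * Real.pi * Complex.I : ℂ) ≠ 0 := Complex.two_pi_I_ne_zero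
  suffices ∃ c : ℂ, M.fourierCoef M.potF₁ n = -(c * n.2) ∧ M.fourierCoef M.potF₂ n = c * n.1 by
    obtain ⟨c, h₁, h₂⟩ := this
    refine ⟨c / (2 * Real.pi * Complex.I), ?_⟩
    rw [jSch, smul_smul, div_mul_cancel₀ _ two_pi_I_ne, fSch, linSch, h₁, h₂, iSch]
    module
  by_cases h₁ : n.1 = 0
  · have h₂ : (n.2 : ℂ) ≠ 0 := Int.cast_ne_zero.2 fun h₂ => hn (Prod.ext h₁ h₂)
    refine ⟨-M.fourierCoef M.potF₁ n / n.2, by field_simp, ?_⟩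
    simpa [h₁, h₂] using gauge
  · have h₁' : (n.1 : ℂ) ≠ 0 := Int.cast_ne_zero.2 h₁
    refine ⟨M.fourierCoef M.potF₂ n / n.1, ?_, by field_simp⟩
    field_simp
    linear_combination gauge

theorem isFormalAdjoint_expRem (n : ℤ × ℤ) (k : ℕ) (δ : ℝ) :
    IsFormalAdjoint schIncl (M.expRem n k δ) (M.expRem (-n) k δ) :=
  (M.isWeakFlow_expSch n).isFormalAdjoint_taylorRem (M.isWeakFlow_expSch (-n))
    (M.isFormalAdjoint_expSch n) k δ

theorem isFormalAdjoint_expRem_fSch (hs : M.AssumptionAs) (hdiv : M.DivFree) (n : ℤ × ℤ) (k : ℕ)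
    {δ : ℝ} (hδ : 0 ≤ δ) : IsFormalAdjoint schIncl (M.expRem n (k + 1) δ ∘L M.fSch n)
      (M.expRem (-n) (k + 1) δ ∘L M.fSch (-n)) := by
  by_cases hn : n = 0
  · have expRem_zero (φ : Sch) : M.expRem 0 (k + 1) δ φ = 0 := by
      simpa [iSch] using norm_expRem_le (M := M) 0 (k + 1) hδ φ
    intro φ χ
    simp [hn, expRem_zero]
  · obtain ⟨c, hc⟩ := exists_fSch_eq_smul_jSch hs hdiv hn
    have flow := M.isWeakFlow_expSch n
    have flow' := M.isWeakFlow_expSch (-n)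
    have adjoint := M.isFormalAdjoint_expSch n
    have fSch_neg : M.fSch (-n) = starRingEnd ℂ c • M.jSch (-n) := by
      have generators := ((flow.isFormalAdjoint_pow flow' adjoint 1).smul c).unique
        denseRange_schIncl (by
          simpa only [hc, pow_one, ContinuousLinearMap.comp_smul] using
            isFormalAdjoint_fSch (M := M) n)
      ext1 φ
      refine injective_schIncl ?_
      simpa using (DFunLike.congr_fun generators φ).symm
    rw [hc, fSch_neg, expRem, expRem, ContinuousLinearMap.comp_smul,
      ContinuousLinearMap.comp_smul]
    exact (flow.isFormalAdjoint_taylorRem_comp flow' adjoint (k + 1) δ).smul c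

theorem isFormalAdjoint_remTerm (hs : M.AssumptionAs) (hdiv : M.DivFree) {δ : ℝ} (hδ : 0 ≤ δ)
    (p x : ℝ) (n : ℤ × ℤ) :
    IsFormalAdjoint schIncl (M.remTerm δ p x n) (M.remTerm δ p x (-n)) := by
  have vector := (isFormalAdjoint_expRem_fSch hs hdiv n (2 * M.nat + 1) hδ).real_smul δ
  have scalar := ((isFormalAdjoint_expRem (M := M) n (2 * M.nat + 1) δ).smul
    (M.fourierCoef M.potV n)).real_smul (δ ^ 2)
  simpa only [remTerm, phase_neg, fourierCoef_conj] using (vector.add scalar).smul (phase p x n)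

end BlochLandau

/-! ### Modes of the remainder symbol -/

theorem sum_Icc_one_add {X : Type*} [AddCommMonoid X] (N : ℕ) {w v : ℕ → X} (hv : v 1 = 0) :
    ∑ j ∈ Finset.Icc 1 (N + 1), (w j + v j)
      = ∑ j ∈ Finset.range (N + 1), w (j + 1) + ∑ j ∈ Finset.range N, v (j + 2) := by
  have drop_first : ∑ j ∈ Finset.range (N + 1), v (j + 1) = ∑ j ∈ Finset.range N, v (j + 2) := by
    rw [Finset.sum_range_succ', hv, add_zero]
  rw [← drop_first, ← Finset.sum_add_distrib, Finset.range_eq_Ico,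
    Finset.sum_Ico_add' (fun j => w j + v j), zero_add, Finset.Ico_add_one_right_eq_Icc]

namespace BlochLandau

variable {M : BlochLandau}

theorem norm_expI_apply (δ : ℝ) (n : ℤ × ℤ) (ψ : Hf) : ‖M.expI δ n ψ‖ = ‖ψ‖ :=
  norm_weyl_apply _ _ _ _

theorem hasModes_symW (hs : M.AssumptionAs) (δ p x : ℝ) : M.HasModes (M.symW δ p x)
    fun n => phase p x n • (M.expSch n δ ∘L M.fSch n) := by
  refine .opSeries ((xiSummable_iSch_pow_fSch hs (Nat.zero_le _)).of_norm_le zero_le_one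
    fun n φ => ?_) fun n => ?_
  · simp [norm_smul, norm_phase, expSch, norm_expI_apply]
  · have extends_Q := ExtendsOnCore.closedOp (M := M) isFormalAdjoint_Q fun φ => by
      simpa [linSch] using M.norm_linSch_le_xi 1 0 φ
    have extends_P := ExtendsOnCore.closedOp M.isFormalAdjoint_P fun φ => by
      simpa [linSch] using M.norm_linSch_le_xi 0 1 φ
    have extends_mode := (((extends_Q.smul (M.fourierCoef M.potF₁ n)).add
      (extends_P.smul (M.fourierCoef M.potF₂ n))).compPMap (M.expI δ n)).smul (phase p x n)
    convert extends_mode using 2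
    ext φ
    simp [expSch, fSch, linSch]

theorem hasModes_symV (hs : M.AssumptionAs) (δ p x : ℝ) : M.HasModes (M.symV δ p x)
    fun n => (M.fourierCoef M.potV n * phase p x n) • M.expSch n δ := by
  refine .opSeries ((xiSummable_coef_smul_iSch_pow hs (Nat.zero_le _)).of_norm_le zero_le_one
    fun n φ => ?_) fun n => (ExtendsOnCore.toPMap (M.expI δ n)).smul _
  simp [norm_smul, norm_phase, expSch, norm_expI_apply]

theorem hasModes_coefW_succ (hs : M.AssumptionAs) (p x : ℝ) {j : ℕ} (hj : j ≤ 2 * M.nat + 1) :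
    M.HasModes (M.coefW p x (j + 1)) fun n => ((2 * Real.pi * Complex.I) ^ j / j.factorial : ℂ) •
      phase p x n • (schIncl ∘L ((M.iSch n ^ j) ∘L M.fSch n)) := by
  have summable_modes := xiSummable_iSch_pow_fSch hs hj
  refine HasModes.smul (.opSeries (summable_modes.of_norm_le zero_le_one fun n φ => ?_)
    fun n => ?_) _
  · simp [norm_smul, norm_phase]
  · obtain ⟨B, -, hB⟩ := summable_modes
    exact (ExtendsOnCore.closedOp ((M.isFormalAdjoint_iSch_pow n j).comp (isFormalAdjoint_fSch n))
      (hB n)).smul _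

theorem hasModes_coefV_add_two (hs : M.AssumptionAs) (p x : ℝ) {j : ℕ} (hj : j ≤ 2) :
    M.HasModes (M.coefV p x (j + 2)) fun n => ((2 * Real.pi * Complex.I) ^ j / j.factorial : ℂ) •
      (phase p x n * M.fourierCoef M.potV n) • (schIncl ∘L M.iSch n ^ j) := by
  refine HasModes.smul (.opSeries ((xiSummable_coef_smul_iSch_pow hs hj).of_norm_le zero_le_one
    fun n φ => ?_) fun n => ?_) _
  · simp [norm_smul, norm_phase]
  · exact (ExtendsOnCore.closedOp (M.isFormalAdjoint_iSch_pow n j)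
      (M.norm_iSch_pow_le_xi n hj)).smul _

theorem expRem_eq (n : ℤ × ℤ) (k : ℕ) (δ : ℝ) : M.expRem n k δ = M.expSch n δ
    - ∑ j ∈ Finset.range k, ((δ ^ j : ℝ) : ℂ) •
      ((2 * Real.pi * Complex.I) ^ j / j.factorial : ℂ) • (schIncl ∘L M.iSch n ^ j) := by
  rw [expRem, taylorRem]
  congr 1
  refine Finset.sum_congr rfl fun j _ => ?_
  rw [jSch, smul_pow, ContinuousLinearMap.comp_smul, smul_smul, smul_smul]
  congr 1
  push_cast
  ring

theorem symApprox_eq (δ p x : ℝ) : M.symApprox δ p x = M.xi +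
    (∑ j ∈ Finset.range (2 * M.nat + 1 + 1), ((δ ^ (j + 1) : ℝ) : ℂ) • M.coefW p x (j + 1)
      + ∑ j ∈ Finset.range (2 * M.nat + 1), ((δ ^ (j + 2) : ℝ) : ℂ) • M.coefV p x (j + 2)) := by
  simp only [symApprox, coefH, smul_add_linearPMap]
  rw [show 2 * (1 + M.nat) = 2 * M.nat + 1 + 1 by ring,
    sum_Icc_one_add (w := fun j => ((δ ^ j : ℝ) : ℂ) • M.coefW p x j)
      (v := fun j => ((δ ^ j : ℝ) : ℂ) • M.coefV p x j) _ (smul_zero_linearPMap _)]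

theorem hasModes_symH (hs : M.AssumptionAs) (δ p x : ℝ) :
    ∃ S, M.symH δ p x = M.xi + S ∧ M.HasModes S fun n =>
      phase p x n • ((δ : ℂ) • (M.expSch n δ ∘L M.fSch n)
        + ((δ ^ 2 : ℝ) : ℂ) • M.fourierCoef M.potV n • M.expSch n δ) := by
  refine ⟨_, add_assoc _ _ _, ?_⟩
  convert ((hasModes_symW hs δ p x).smul (δ : ℂ)).add
    ((hasModes_symV hs δ p x).smul ((δ ^ 2 : ℝ) : ℂ)) using 1
  funext n
  simp only [Pi.add_apply, Pi.smul_apply]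
  module

theorem hasModes_symApprox (hs : M.AssumptionAs) (δ p x : ℝ) :
    ∃ S, M.symApprox δ p x = M.xi + S ∧ M.HasModes S fun n => phase p x n •
      ((δ : ℂ) • ((M.expSch n δ - M.expRem n (2 * M.nat + 2) δ) ∘L M.fSch n)
        + ((δ ^ 2 : ℝ) : ℂ) • M.fourierCoef M.potV n •
          (M.expSch n δ - M.expRem n (2 * M.nat + 1) δ)) := by
  have nat_le : 2 * M.nat ≤ 2 := by
    rcases M.nat_cases with h | ⟨h, -⟩ <;> omega
  have coefW (j) (hj : j ∈ Finset.range (2 * M.nat + 1 + 1)) :=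
    (hasModes_coefW_succ hs p x (Nat.le_of_lt_succ (Finset.mem_range.1 hj))).smul
      ((δ ^ (j + 1) : ℝ) : ℂ)
  have coefV (j) (hj : j ∈ Finset.range (2 * M.nat + 1)) :=
    (hasModes_coefV_add_two hs p x ((Nat.le_of_lt_succ (Finset.mem_range.1 hj)).trans nat_le)).smul
      ((δ ^ (j + 2) : ℝ) : ℂ)
  refine ⟨_, symApprox_eq δ p x, ?_⟩
  convert (HasModes.sum coefW).add (HasModes.sum coefV) using 1
  funext n
  simp only [expRem_eq, sub_sub_cancel, Pi.add_apply, Finset.sum_apply, Pi.smul_apply, smul_add,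
    ContinuousLinearMap.finsetSum_comp, ContinuousLinearMap.smul_comp, Finset.smul_sum]
  congr 1 <;>
  · refine Finset.sum_congr rfl fun j _ => ?_
    simp only [ContinuousLinearMap.comp_assoc, smul_smul]
    congr 1
    push_cast
    ring

theorem hasModes_remainder (hs : M.AssumptionAs) (δ p x : ℝ) :
    M.HasModes (M.remainder δ p x) (M.remTerm δ p x) := by
  obtain ⟨S, symH_eq, modes_S⟩ := hasModes_symH hs δ p x
  obtain ⟨T, symApprox_eq, modes_T⟩ := hasModes_symApprox hs δ p x
  rw [remainder, symH_eq, symApprox_eq]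
  convert modes_S.xi_add_sub_xi_add modes_T using 1
  funext n
  simp only [remTerm, Pi.sub_apply, ContinuousLinearMap.sub_comp]
  module

/-! ### The estimates -/

theorem exists_normFLe_remainder (hs : M.AssumptionAs) : ∃ C : ℝ, ∀ δ : ℝ, 0 < δ → ∀ p x : ℝ,
    M.NormFLe (M.remainder δ p x) (C * δ ^ (2 * (M.nat + 1))) := by
  obtain ⟨B, summable_B, hB⟩ := exists_norm_remTerm_le_xi hs
  refine ⟨∑' n, B n, fun δ hδ p x => ?_⟩
  have bound := (hasModes_remainder hs δ p x).normFLe (summable_B.mul_left _) (hB δ hδ.le p x)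
  rwa [tsum_mul_left, mul_comm] at bound

theorem exists_remainder_hermiteSpan_le (hs : M.AssumptionAs) {χ : Sch}
    (hχ : χ ∈ M.hermiteSpan) : ∃ C : ℝ, ∀ δ : ℝ, 0 < δ → ∀ p x : ℝ, ∃ v : Hf,
      (schIncl χ, v) ∈ (M.remainder δ p x).graph ∧ ‖v‖ ≤ C * δ ^ (2 * (M.nat + 1) + 1) := by
  obtain ⟨B, summable_B, hB⟩ := exists_norm_remTerm_le hs χ
  refine ⟨∑' n, B n, fun δ hδ p x => ?_⟩
  obtain ⟨v, sum_v, hv⟩ := (hasModes_remainder hs δ p x).hasSum hχ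
  refine ⟨v, hv, ?_⟩
  rw [← sum_v.tsum_eq, mul_comm, ← tsum_mul_left]
  exact tsum_of_norm_bounded (summable_B.mul_left _).hasSum (hB δ hδ.le p x)

theorem inner_remainder (hs : M.AssumptionAs) (hdiv : M.DivFree) {δ : ℝ} (hδ : 0 ≤ δ) {p x : ℝ}
    {χ : Sch} (hχ : χ ∈ M.hermiteSpan) {v : Hf} (hv : (schIncl χ, v) ∈ (M.remainder δ p x).graph)
    (ψ : M.xi.domain) {w : Hf} (hw : ((ψ : Hf), w) ∈ (M.remainder δ p x).graph) :
    inner ℂ v (ψ : Hf) = inner ℂ (schIncl χ) w :=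
  (hasModes_remainder hs δ p x).inner_eq (.neg _) (isFormalAdjoint_remTerm hs hdiv hδ p x) hχ hv
    (M.xi.mem_graph ψ) hw

/-! ### Composition with the projections -/

theorem hermite_mem_hermiteSpan (k : ℕ) : M.hermite k ∈ M.hermiteSpan :=
  Submodule.subset_span ⟨k, rfl⟩

variable (M) in
/-- The finite rank operator `∑_{k ∈ s} |v_k⟩⟨ψ_k|`; it is `T π_r` for every operator `T` that maps
the Hermite functions `ψ_k` to `v_k`. -/
def rankSum (s : Finset ℕ) (v : ℕ → Hf) : Hf →L[ℂ] Hf :=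
  ∑ k ∈ s, InnerProductSpace.rankOne ℂ (v k) (schIncl (M.hermite k))

theorem norm_rankSum_le (s : Finset ℕ) {v : ℕ → Hf} {C : ℕ → ℝ} {r : ℝ}
    (hv : ∀ k, ‖v k‖ ≤ C k * r) :
    ‖M.rankSum s v‖ ≤ (∑ k ∈ s, C k * ‖schIncl (M.hermite k)‖) * r := by
  rw [Finset.sum_mul]
  refine (norm_sum_le _ _).trans (Finset.sum_le_sum fun k _ => ?_)
  rw [InnerProductSpace.norm_rankOne, mul_right_comm]
  exact mul_le_mul_of_nonneg_right (hv k) (norm_nonneg _)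

theorem isRightComp_rankSum {T : Hf →ₗ.[ℂ] Hf} {v : ℕ → Hf}
    (hv : ∀ k, (schIncl (M.hermite k), v k) ∈ T.graph) (s : Finset ℕ) :
    M.IsRightComp T s (M.rankSum s v) := fun ψ => by
  have combination : (M.proj s ψ, M.rankSum s v ψ)
      = ∑ k ∈ s, inner ℂ (schIncl (M.hermite k)) ψ • (schIncl (M.hermite k), v k) := by
    simp [rankSum, proj, Prod.ext_iff, Prod.fst_sum, Prod.snd_sum]
  have mem_graph : (M.proj s ψ, M.rankSum s v ψ) ∈ T.graph :=
    combination ▸ Submodule.sum_mem _ fun k _ => Submodule.smul_mem _ _ (hv k)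
  obtain ⟨dom, value⟩ := mem_graph_iff_exists.1 mem_graph
  exact ⟨dom, value.symm⟩

theorem isLeftComp_adjoint_rankSum {T : Hf →ₗ.[ℂ] Hf} {v : ℕ → Hf}
    (hT : M.xi.domain ≤ T.domain)
    (hv : ∀ k, ∀ ψ : M.xi.domain, ∀ w : Hf, ((ψ : Hf), w) ∈ T.graph →
      inner ℂ (v k) (ψ : Hf) = inner ℂ (schIncl (M.hermite k)) w)
    (s : Finset ℕ) : M.IsLeftComp T s (ContinuousLinearMap.adjoint (M.rankSum s v)) := fun ψ => by
  refine ⟨hT ψ.2, ?_⟩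
  simp only [rankSum, proj, map_sum, InnerProductSpace.adjoint_rankOne, sum_apply,
    InnerProductSpace.rankOne_apply, hv _ ψ _ (T.mem_graph ⟨ψ, hT ψ.2⟩)]

theorem norm_sub_adjoint_le (S : Hf →L[ℂ] Hf) :
    ‖S - ContinuousLinearMap.adjoint S‖ ≤ 2 * ‖S‖ := by
  simpa [two_mul] using norm_sub_le S (ContinuousLinearMap.adjoint S)

end BlochLandau

end

theorem proposition4p5 (M : BlochLandau) (hs : M.AssumptionAs) (hdiv : M.DivFree) :
    (∃ C : ℝ, ∀ δ : ℝ, 0 < δ → ∀ p x : ℝ,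
      M.NormFLe (M.remainder δ p x) (C * δ ^ (2 * (M.nat + 1)))) ∧
    ∀ s : Finset ℕ, ∃ C : ℝ, ∀ δ : ℝ, 0 < δ → ∀ p x : ℝ,
      ∃ S T : Hf →L[ℂ] Hf,
        M.IsRightComp (M.remainder δ p x) s S ∧
        M.IsLeftComp (M.remainder δ p x) s T ∧
        ‖S‖ = ‖T‖ ∧
        ‖S‖ ≤ C * δ ^ (2 * (M.nat + 1) + 1) ∧
        ‖S - T‖ ≤ C * δ ^ (2 * (M.nat + 1) + 1) := by
  have relative_bound := BlochLandau.exists_normFLe_remainder hs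
  refine ⟨relative_bound, fun s => ?_⟩
  obtain ⟨_, normFLe⟩ := relative_bound
  choose C hC using fun k =>
    BlochLandau.exists_remainder_hermiteSpan_le hs (M.hermite_mem_hermiteSpan k)
  refine ⟨2 * ∑ k ∈ s, C k * ‖schIncl (M.hermite k)‖, fun δ hδ p x => ?_⟩
  choose v hv hle using fun k => hC k δ hδ p x
  have norm_le := M.norm_rankSum_le s hle
  have symmetric (k) := BlochLandau.inner_remainder hs hdiv hδ.le (M.hermite_mem_hermiteSpan k)
    (hv k)
  refine ⟨M.rankSum s v, ContinuousLinearMap.adjoint (M.rankSum s v),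
    BlochLandau.isRightComp_rankSum hv s,
    BlochLandau.isLeftComp_adjoint_rankSum (fun ψ hψ => (normFLe δ hδ p x ⟨ψ, hψ⟩).1) symmetric s,
    (LinearIsometryEquiv.norm_map _ _).symm, ?_, ?_⟩
  · linarith [norm_nonneg (M.rankSum s v)]
  · linarith [BlochLandau.norm_sub_adjoint_le (M.rankSum s v)]
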